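/- Let $G$ be a connected, simply connected, nilpotent (finite-dimensional) complex Lie group with Lie algebra $\mathfrak g$, let $G_0\subset G$ be a connected (simply connected) real Lie subgroup with real Lie algebra $\mathfrak g_0\subset\mathfrak g$, and let $\Gamma$ be a discrete subgroup of $G_0$ with $G_0/\Gamma$ compact. Assume that $\mathfrak g_0+i\mathfrak g_0=\mathfrak g$, i.e. that $(\Gamma,G_0,G)$ is a (generic) CR-solvmanifold. Assume further that $(\Gamma,G_0,G)$ is locally Kähler, i.e. that $Y=G_0/\Gamma$ has an open neighbourhood in the complex manifold $X=G/\Gamma$ which admits a Kähler form. Put $\mathfrak m=\mathfrak g_0\cap i\mathfrak g_0$ (an ideal of $\mathfrak g$), let $\mathfrak z$ and $\mathfrak z_0$ be the centers of $\mathfrak g$ and $\mathfrak g_0$, and let $\mathfrak g'=[\mathfrak g,\mathfrak g]$. Then $$\mathfrak m\subset\mathfrak z,\qquad \mathfrak m\cap\mathfrak g'=\{0\},\qquad \mathfrak z=\mathfrak z_0+i\mathfrak z_0 .$$ -/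

import Mathlib

open scoped Manifold ContDiff Pointwise Topology

noncomputable section

namespace CRSolv

/-! ### Kähler forms on open subsets of a complex manifold -/

section Kahler

variable {E : Type*} [NormedAddCommGroup E] [NormedSpace ℂ E]
  {M : Type*} [TopologicalSpace M] [ChartedSpace E M]

/-- The expression of a real `2`-form `η` on the complex manifold `M` in the chart `e`, that is,
its pullback under the inverse chart `e.symm`. -/
def coordForm (η : ∀ x : M, TangentSpace 𝓘(ℂ, E) x [⋀^Fin 2]→L[ℝ] ℝ)
    (e : OpenPartialHomeomorph M E) (y : E) : E [⋀^Fin 2]→L[ℝ] ℝ :=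
  (η (e.symm y)).compContinuousLinearMap
    ((mfderiv 𝓘(ℂ, E) 𝓘(ℂ, E) e.symm y).restrictScalars ℝ)

/-- `η` is a Kähler form on the open subset `U` of the complex manifold `M`: a smooth closed real
`2`-form which is invariant under the complex structure `J` (multiplication by `i`) and
positive, `η(v, J v) > 0` for `v ≠ 0`. The values of `η` outside `U` are irrelevant. -/
structure IsKahlerFormOn (η : ∀ x : M, TangentSpace 𝓘(ℂ, E) x [⋀^Fin 2]→L[ℝ] ℝ)
    (U : Set M) : Prop where
  smooth : ∀ e ∈ atlas E M, ContDiffOn ℝ ∞ (coordForm η e) (e.target ∩ e.symm ⁻¹' U)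
  closed : ∀ e ∈ atlas E M, ∀ y ∈ e.target ∩ e.symm ⁻¹' U, extDeriv (coordForm η e) y = 0
  invariant : ∀ x ∈ U, ∀ v w : TangentSpace 𝓘(ℂ, E) x,
    η x ![Complex.I • v, Complex.I • w] = η x ![v, w]
  pos : ∀ x ∈ U, ∀ v : TangentSpace 𝓘(ℂ, E) x, v ≠ 0 → 0 < η x ![v, Complex.I • v]

end Kahler

/-! ### The Lie algebra of a closed subgroup of a complex Lie group -/

section LieAlg

variable (E : Type*) [NormedAddCommGroup E] [NormedSpace ℂ E]
  {G : Type*} [TopologicalSpace G] [ChartedSpace E G] [Group G]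

/-- The (real) Lie algebra `𝔤₀ ⊆ 𝔤` of a closed subgroup `G₀` of the complex Lie group `G`:
the tangent space of `G₀` at `1`, i.e. the set of the velocities at time `0` of the smooth curves
in `G` that run inside `G₀` and start at `1`. (The tangent space of `G` at `1` is identified with
the model space `E` by means of the preferred chart at `1`.) -/
def subLie (G₀ : Subgroup G) : Set (GroupLieAlgebra 𝓘(ℂ, E) G) :=
  {v | ∃ γ : ℝ → G, ContMDiff 𝓘(ℝ, ℝ) 𝓘(ℝ, E) ∞ γ ∧ (∀ t, γ t ∈ G₀) ∧ γ 0 = 1 ∧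
    HasDerivAt (fun t => chartAt E (1 : G) (γ t)) (v : E) 0}

/-- `𝔪 = 𝔤₀ ∩ i 𝔤₀`. -/
def complexPart (G₀ : Subgroup G) : Set (GroupLieAlgebra 𝓘(ℂ, E) G) :=
  subLie E G₀ ∩ Complex.I • subLie E G₀

/-- The center `𝔷₀` of `𝔤₀`. -/
def centerSubLie (G₀ : Subgroup G) : Set (GroupLieAlgebra 𝓘(ℂ, E) G) :=
  {x | x ∈ subLie E G₀ ∧ ∀ y ∈ subLie E G₀, ⁅x, y⁆ = 0}

end LieAlg

/-! ### The complex manifold `G / Γ` -/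

section Quotient

theorem isLocalHomeomorph_mk (E : Type*) [NormedAddCommGroup E] [NormedSpace ℂ E]
    {G : Type*} [TopologicalSpace G] [ChartedSpace E G] [Group G] [LieGroup 𝓘(ℂ, E) ω G]
    (Γ : Subgroup G) (hΓ : DiscreteTopology Γ) :
    IsLocalHomeomorph (QuotientGroup.mk : G → G ⧸ Γ) := by
  have : IsTopologicalGroup G := topologicalGroup_of_lieGroup 𝓘(ℂ, E) ω
  exact (Γ.isQuotientCoveringMap ⟨hΓ⟩).isCoveringMap.isLocalHomeomorph

/-- The atlas of `G / Γ`, for a discrete subgroup `Γ` of the complex Lie group `G`: its charts are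
the local inverses of the covering `G → G / Γ` followed by the charts of `G`. -/
@[reducible]
def quotientChartedSpace (E : Type*) [NormedAddCommGroup E] [NormedSpace ℂ E]
    {G : Type*} [TopologicalSpace G] [ChartedSpace E G] [Group G] [LieGroup 𝓘(ℂ, E) ω G]
    (Γ : Subgroup G) (hΓ : DiscreteTopology Γ) : ChartedSpace E (G ⧸ Γ) :=
  (isLocalHomeomorph_mk E Γ hΓ).chartedSpace QuotientGroup.mk_surjective

/-- With this atlas, `G / Γ` is a complex manifold. -/
theorem isManifold_quotient (E : Type*) [NormedAddCommGroup E] [NormedSpace ℂ E]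
    {G : Type*} [TopologicalSpace G] [ChartedSpace E G] [Group G] [LieGroup 𝓘(ℂ, E) ω G]
    (Γ : Subgroup G) (hΓ : DiscreteTopology Γ) :
    letI := quotientChartedSpace E Γ hΓ
    IsManifold 𝓘(ℂ, E) ω (G ⧸ Γ) := by
  let _ := quotientChartedSpace E Γ hΓ
  have hG : IsTopologicalGroup G := topologicalGroup_of_lieGroup 𝓘(ℂ, E) ω
  have hl := isLocalHomeomorph_mk E Γ hΓ
  suffices H : ∀ a b : G, ContDiffOn ℂ ω
      (((hl.localInverseAt a) ≫ₕ chartAt E a).symm ≫ₕ ((hl.localInverseAt b) ≫ₕ chartAt E b))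
      (((hl.localInverseAt a) ≫ₕ chartAt E a).symm ≫ₕ
        ((hl.localInverseAt b) ≫ₕ chartAt E b)).source by
    apply isManifold_of_contDiffOn
    rintro _ _ ⟨q, rfl⟩ ⟨q', rfl⟩
    simpa using H _ _
  intro a b y hy
  simp only [OpenPartialHomeomorph.trans_source, OpenPartialHomeomorph.symm_source,
    OpenPartialHomeomorph.trans_target, OpenPartialHomeomorph.coe_trans_symm, Set.mem_inter_iff,
    Set.mem_preimage, Function.comp_apply, IsLocalHomeomorph.localInverseAt_symm] at hy
  obtain ⟨⟨hy1, hy2⟩, hy3, hy4⟩ := hy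
  set p := (chartAt E a).symm y with hp
  set r := hl.localInverseAt b (p : G ⧸ Γ) with hr
  have hrp : (r : G ⧸ Γ) = p := hl.apply_localInverseAt_of_mem hy3
  obtain ⟨c, hc⟩ : ∃ c : G, p * c = r := ⟨p⁻¹ * r, by group⟩
  have hcΓ : c ∈ Γ := by
    have := QuotientGroup.eq.1 hrp.symm
    rwa [← hc, inv_mul_cancel_left] at this
  have hpc : ContinuousAt (chartAt E a).symm y :=
    (chartAt E a).continuousAt_symm hy1
  -- near `y` the transition map is the right translation by `c`, read in charts
  have hev : (((hl.localInverseAt a) ≫ₕ chartAt E a).symm ≫ₕ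
      ((hl.localInverseAt b) ≫ₕ chartAt E b)) =ᶠ[𝓝 y]
      fun z => chartAt E b ((chartAt E a).symm z * c) := by
    have h1 : ∀ᶠ z in 𝓝 y, (chartAt E a).symm z * c ∈ (hl.localInverseAt b).target := by
      have : ContinuousAt (fun z => (chartAt E a).symm z * c) y := hpc.mul continuousAt_const
      refine this.eventually_mem ((hl.localInverseAt b).open_target.mem_nhds ?_)
      change p * c ∈ _
      rw [hc]
      exact (hl.localInverseAt b).map_source hy3
    filter_upwards [h1] with z hz
    have e1 : (((chartAt E a).symm z : G) : G ⧸ Γ) = (((chartAt E a).symm z * c : G) : G ⧸ Γ) := by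
      rw [QuotientGroup.eq, inv_mul_cancel_left]
      exact hcΓ
    simp only [OpenPartialHomeomorph.coe_trans, OpenPartialHomeomorph.coe_trans_symm,
      Function.comp_apply, IsLocalHomeomorph.localInverseAt_symm]
    rw [e1]
    congr 1
    have := (hl.localInverseAt b).right_inv hz
    rwa [IsLocalHomeomorph.localInverseAt_symm] at this
  have hsm : ContMDiffAt 𝓘(ℂ, E) 𝓘(ℂ, E) ω (fun z => chartAt E b ((chartAt E a).symm z * c)) y := by
    have hM : IsManifold 𝓘(ℂ, E) ω G := inferInstance
    have k1 : ContMDiffAt 𝓘(ℂ, E) 𝓘(ℂ, E) ω (chartAt E a).symm y :=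
      (contMDiffOn_chart_symm (I := 𝓘(ℂ, E)) (n := ω) (x := a)).contMDiffAt
        ((chartAt E a).open_target.mem_nhds hy1)
    have k2 : ContMDiffAt 𝓘(ℂ, E) 𝓘(ℂ, E) ω (fun x : G => x * c) p :=
      contMDiff_mul_right.contMDiffAt
    have k3 : ContMDiffAt 𝓘(ℂ, E) 𝓘(ℂ, E) ω (chartAt E b) (p * c) :=
      (contMDiffOn_chart (I := 𝓘(ℂ, E)) (n := ω) (x := b)).contMDiffAt
        ((chartAt E b).open_source.mem_nhds (by rw [hc]; exact hy4))
    exact ContMDiffAt.comp y (g := chartAt E b) k3 (ContMDiffAt.comp y k2 k1)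
  exact (contMDiffAt_iff_contDiffAt.1 hsm |>.congr_of_eventuallyEq hev).contDiffWithinAt

end Quotient

/-! ### CR-solvmanifolds -/

section CRS

variable (E : Type*) [NormedAddCommGroup E] [NormedSpace ℂ E]
  {G : Type*} [TopologicalSpace G] [ChartedSpace E G] [Group G] [LieGroup 𝓘(ℂ, E) ω G]

/-- `(Γ, G₀, G)` is a (generic) CR-solvmanifold: `G` is a connected simply connected solvable
complex Lie group, `G₀` is a connected simply connected real Lie subgroup, `Γ` is a discrete
cocompact subgroup of `G₀`, and `𝔤₀ + i 𝔤₀ = 𝔤`. (Mathlib's simply connected spaces are nonempty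
and path connected. A closed subgroup is a real Lie subgroup, and the connected Lie subgroups of a
simply connected solvable Lie group are closed.) -/
structure IsCRSolvmanifold (Γ G₀ : Subgroup G) : Prop where
  simplyConnected : SimplyConnectedSpace G
  solvable : Group.IsSolvable G
  closed : IsClosed (G₀ : Set G)
  simplyConnected₀ : SimplyConnectedSpace G₀
  le : Γ ≤ G₀
  discrete : DiscreteTopology Γ
  cocompact : CompactSpace (G₀ ⧸ Γ.subgroupOf G₀)
  generic : subLie E G₀ + Complex.I • subLie E G₀ = Set.univ

variable {E}

/-- The CR-solvmanifold `(Γ, G₀, G)` is locally Kähler: the submanifold `Y = G₀ / Γ` of the complex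
manifold `X = G / Γ` has an open neighbourhood in `X` that carries a Kähler form. -/
def IsCRSolvmanifold.IsLocallyKahler {Γ G₀ : Subgroup G} (h : IsCRSolvmanifold E Γ G₀) : Prop :=
  letI : ChartedSpace E (G ⧸ Γ) := quotientChartedSpace E Γ h.discrete
  ∃ (U : Set (G ⧸ Γ)) (η : ∀ x : G ⧸ Γ, TangentSpace 𝓘(ℂ, E) x [⋀^Fin 2]→L[ℝ] ℝ),
    IsOpen U ∧ (QuotientGroup.mk : G → G ⧸ Γ) '' (G₀ : Set G) ⊆ U ∧ IsKahlerFormOn η U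

end CRS

end CRSolv

end

/-! The Kähler form is averaged to a form on the Lie algebra; linear algebra does the rest.

Each `V ∈ 𝔤` generates, through left translations, a vector field on `G ⧸ Γ`, and `pairing η π V W`
is the value of `η` on two such fields. Let `β V W` be the mean of this function over `G₀`; a mean
exists because nilpotent groups are amenable (`exists_isInvariantMean`), so no Haar measure is
needed. Compactness of `G₀ ⧸ Γ` bounds these functions and keeps `η(V, iV)` above a positive
constant, so `β V (iV) > 0` for `V ≠ 0`. When `dη = 0` is expanded on three generators from `𝔤₀`,
the terms that are derivatives along `𝔤₀` have mean zero by invariance. What remains is the cocycle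
identity for `β` on `𝔤₀` (`exists_averaged_form`).

The algebra is in `structure_of_closed_form`. By the cocycle identity, `[𝔤₀, 𝔤₀]` is `β`-orthogonal
to every element of `𝔤₀` that is central in `𝔤`. Hence a central `u ∈ 𝔪 ∩ [𝔤₀, 𝔤₀]` has `β u (iu) =
0` and vanishes. For `v ∈ 𝔪` and `x ∈ 𝔤₀` the bracket `[x, v]` lies in `𝔪 ∩ [𝔤₀, 𝔤₀]`; induction
along a central filtration makes it central, hence zero, so `𝔪` is central. An element of `𝔪 ∩ 𝔤'`
is `a + ib` with `a, b ∈ [𝔤₀, 𝔤₀]`; then `a, b ∈ 𝔪`, and both vanish. If `a + ib` is central with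
`a, b ∈ 𝔤₀`, then `[a, y] = -i[b, y]` puts `[b, y]` in `𝔪 ∩ 𝔤' = 0` for `y ∈ 𝔤₀`.

The link between group and Lie algebra is that the bracket is the derivative of the adjoint action
along any curve (`bracket_eq_sub`, `HasVelocity.hasDerivAt_adjoint`). It is computed in the chart at
`1`, without the exponential map, and also gives the filtration (`adjointFiltration`). -/

namespace CRSolv

/-! ### Invariant means on nilpotent groups -/

section Mean

/-- A real function is bounded if its absolute value is. -/
def IsBdd {α : Type*} (f : α → ℝ) : Prop := ∃ C, ∀ x, |f x| ≤ C

theorem IsBdd.add {α : Type*} {f g : α → ℝ} (hf : IsBdd f) (hg : IsBdd g) : IsBdd (f + g) := by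
  obtain ⟨C, hC⟩ := hf
  obtain ⟨D, hD⟩ := hg
  exact ⟨C + D, fun x => (abs_add_le _ _).trans (add_le_add (hC x) (hD x))⟩

theorem IsBdd.smul {α : Type*} {f : α → ℝ} (c : ℝ) (hf : IsBdd f) : IsBdd (c • f) := by
  obtain ⟨C, hC⟩ := hf
  refine ⟨|c| * C, fun x => ?_⟩
  simp only [Pi.smul_apply, smul_eq_mul, abs_mul]
  exact mul_le_mul_of_nonneg_left (hC x) (abs_nonneg c)

theorem isBdd_const {α : Type*} (c : ℝ) : IsBdd (fun _ : α => c) := ⟨|c|, fun _ => le_rfl⟩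

theorem IsBdd.comp {α β : Type*} {f : α → ℝ} (hf : IsBdd f) (φ : β → α) : IsBdd (f ∘ φ) := by
  obtain ⟨C, hC⟩ := hf
  exact ⟨C, fun x => hC (φ x)⟩

theorem IsBdd.neg {α : Type*} {f : α → ℝ} (hf : IsBdd f) : IsBdd (-f) := by
  obtain ⟨C, hC⟩ := hf
  exact ⟨C, fun x => by simpa using hC x⟩

theorem IsBdd.sub {α : Type*} {f g : α → ℝ} (hf : IsBdd f) (hg : IsBdd g) : IsBdd (f - g) := by
  rw [sub_eq_add_neg]
  exact hf.add hg.neg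

/-- The subspace of bounded functions. -/
def bddFun (α : Type*) : Submodule ℝ (α → ℝ) where
  carrier := {f | IsBdd f}
  add_mem' := IsBdd.add
  zero_mem' := isBdd_const 0
  smul_mem' c _ hf := hf.smul c

/-- `Λ` restricts to a left invariant mean on the bounded functions on the group `G`. -/
structure IsInvariantMean {G : Type*} [Group G] (Λ : (G → ℝ) →ₗ[ℝ] ℝ) : Prop where
  le : ∀ f, IsBdd f → ∀ C, (∀ g, f g ≤ C) → Λ f ≤ C
  inv : ∀ f, IsBdd f → ∀ a : G, Λ (fun g => f (a * g)) = Λ f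

theorem IsInvariantMean.ge {G : Type*} [Group G] {Λ : (G → ℝ) →ₗ[ℝ] ℝ} (h : IsInvariantMean Λ)
    {f : G → ℝ} (hf : IsBdd f) {C : ℝ} (hC : ∀ g, C ≤ f g) : C ≤ Λ f := by
  have := h.le (-f) hf.neg (-C) (fun g => by simpa using hC g)
  rw [map_neg] at this
  linarith

theorem IsInvariantMean.abs_le {G : Type*} [Group G] {Λ : (G → ℝ) →ₗ[ℝ] ℝ}
    (h : IsInvariantMean Λ) {f : G → ℝ} {C : ℝ} (hC : ∀ g, |f g| ≤ C) : |Λ f| ≤ C :=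
  _root_.abs_le.2 ⟨h.ge ⟨C, hC⟩ fun g => (_root_.abs_le.1 (hC g)).1,
    h.le _ ⟨C, hC⟩ _ fun g => (_root_.abs_le.1 (hC g)).2⟩

/-- The sum of the differences `h (a g) - h g`, for `(a, h)` in the list. -/
def diffSum {G : Type*} [Group G] (s : List (G × (G → ℝ))) (g : G) : ℝ :=
  (s.map fun x => x.2 (x.1 * g) - x.2 g).sum

theorem diffSum_append {G : Type*} [Group G] (s t : List (G × (G → ℝ))) (g : G) :
    diffSum (s ++ t) g = diffSum s g + diffSum t g := by
  simp [diffSum]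

theorem diffSum_smul {G : Type*} [Group G] (s : List (G × (G → ℝ))) (c : ℝ) (g : G) :
    diffSum (s.map fun x => (x.1, c • x.2)) g = c * diffSum s g := by
  induction s with
  | nil => simp [diffSum]
  | cons x s ih =>
    simp only [diffSum, List.map_cons, List.sum_cons] at ih ⊢
    rw [ih]
    simp
    ring

/-- Powers of `a` commute with the translating elements, so averaging along these powers keeps the
shape of a sum of differences. -/
theorem sum_diffSum_pow {G : Type*} [Group G] (hc : ∀ a b : G, a * b = b * a)
    (s : List (G × (G → ℝ))) (a : G) (N : ℕ) (g : G) :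
    ∑ i ∈ Finset.range N, diffSum s (a ^ i * g) =
      diffSum (s.map fun x => (x.1, fun g => ∑ i ∈ Finset.range N, x.2 (a ^ i * g))) g := by
  induction s with
  | nil => simp [diffSum]
  | cons x s ih =>
    simp only [diffSum, List.map_cons, List.sum_cons] at ih ⊢
    rw [Finset.sum_add_distrib, ih, Finset.sum_sub_distrib]
    congr 2
    refine Finset.sum_congr rfl fun i _ => ?_
    rw [← mul_assoc, ← mul_assoc, hc x.1]

/-- In a commutative group, a sum of differences of bounded functions is not bounded below by a
positive constant. -/
theorem not_le_diffSum {G : Type*} [Group G] (hc : ∀ a b : G, a * b = b * a)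
    (s : List (G × (G → ℝ))) : (∀ x ∈ s, IsBdd x.2) → ∀ ε : ℝ, 0 < ε →
      ¬ ∀ g, ε ≤ diffSum s g := by
  induction hn : s.length generalizing s with
  | zero =>
    rw [List.length_eq_zero_iff] at hn
    subst hn
    intro _ ε hε h
    have := h 1
    simp [diffSum] at this
    linarith
  | succ n ih =>
    match s, hn with
    | (a, h) :: s, hn =>
    intro hb ε hε H
    obtain ⟨C, hC⟩ := hb (a, h) (by simp)
    -- Summed over the first `N` powers of `a`, the difference of `h` telescopes to at most `2 * C`,
    -- while the lower bound grows to `N * ε`. This `N` leaves a positive bound for the remaining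
    -- differences.
    obtain ⟨N, hN⟩ := exists_nat_gt (2 * C / ε)
    rw [div_lt_iff₀ hε] at hN
    refine ih (s.map fun x => (x.1, fun g => ∑ i ∈ Finset.range N, x.2 (a ^ i * g)))
      (by simpa using hn) ?_ (N * ε - 2 * C) (by linarith) ?_
    · intro x hx
      obtain ⟨y, hy, rfl⟩ := List.mem_map.1 hx
      obtain ⟨D, hD⟩ := hb y (by simp [hy])
      refine ⟨∑ i ∈ Finset.range N, D, fun g => ?_⟩
      change |∑ i ∈ Finset.range N, y.2 (a ^ i * g)| ≤ _
      refine (Finset.abs_sum_le_sum_abs _ _).trans ?_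
      exact Finset.sum_le_sum fun i _ => hD _
    · intro g
      rw [← sum_diffSum_pow hc]
      have h1 : ∑ i ∈ Finset.range N, ε ≤ ∑ i ∈ Finset.range N, diffSum ((a, h) :: s) (a ^ i * g) :=
        Finset.sum_le_sum fun i _ => H _
      have h2 : ∑ i ∈ Finset.range N, diffSum ((a, h) :: s) (a ^ i * g) =
          (h (a ^ N * g) - h g) + ∑ i ∈ Finset.range N, diffSum s (a ^ i * g) := by
        simp only [diffSum, List.map_cons, List.sum_cons]
        rw [Finset.sum_add_distrib]
        congr 1
        have := Finset.sum_range_sub (fun i => h (a ^ i * g)) N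
        simp only [pow_succ', mul_assoc, pow_zero, one_mul] at this
        exact this
      rw [h2] at h1
      simp only [Finset.sum_const, Finset.card_range, nsmul_eq_mul] at h1
      have h3 := abs_le.1 (hC (a ^ N * g))
      have h4 := abs_le.1 (hC g)
      simp only at h3 h4
      linarith [h3.2, h4.1]

/-- Hahn–Banach for the sublinear functional sending `f` to the infimum of the `C` with `f ≤ C` plus
a sum of differences. It is finite by `not_le_diffSum`, and nonpositive on differences, which forces
invariance of any functional below it. -/
theorem exists_isInvariantMean_of_comm {G : Type*} [Group G] (hc : ∀ a b : G, a * b = b * a) :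
    ∃ Λ : (G → ℝ) →ₗ[ℝ] ℝ, IsInvariantMean Λ := by
  let S : bddFun G → Set ℝ := fun f =>
    {C | ∃ s : List (G × (G → ℝ)), (∀ x ∈ s, IsBdd x.2) ∧ ∀ g, f.1 g ≤ C + diffSum s g}
  have hne : ∀ f, (S f).Nonempty := by
    rintro ⟨f, C, hC⟩
    exact ⟨C, [], by simp, fun g => by simpa [diffSum] using (abs_le.1 (hC g)).2⟩
  have hbd : ∀ f : bddFun G, ∀ B, (∀ g, B ≤ f.1 g) → ∀ C ∈ S f, B ≤ C := by
    rintro f B hB C ⟨s, hs, hC⟩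
    by_contra! hlt
    exact not_le_diffSum hc s hs (B - C) (by linarith) fun g => by linarith [hB g, hC g]
  have hbb : ∀ f, BddBelow (S f) := by
    rintro ⟨f, C, hC⟩
    exact ⟨-C, fun x hx => hbd ⟨f, C, hC⟩ (-C) (fun g => (abs_le.1 (hC g)).1) x hx⟩
  have hsm : ∀ c : ℝ, 0 < c → ∀ f, ∀ C ∈ S f, c * C ∈ S (c • f) := by
    rintro c hc0 f C ⟨s, hs, hC⟩
    refine ⟨s.map fun x => (x.1, c • x.2), ?_, fun g => ?_⟩
    · intro x hx
      obtain ⟨y, hy, rfl⟩ := List.mem_map.1 hx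
      exact (hs y hy).smul c
    · rw [diffSum_smul, ← mul_add]
      exact mul_le_mul_of_nonneg_left (hC g) hc0.le
  have hle : ∀ c : ℝ, 0 < c → ∀ f, sInf (S (c • f)) ≤ c * sInf (S f) := by
    intro c hc0 f
    rw [← div_le_iff₀' hc0]
    refine le_csInf (hne f) fun C hC => ?_
    rw [div_le_iff₀' hc0]
    exact csInf_le (hbb _) (hsm c hc0 f C hC)
  obtain ⟨L, -, hL⟩ := exists_extension_of_le_sublinear (⊥ : bddFun G →ₗ.[ℝ] ℝ)
    (fun f => sInf (S f)) (fun c hc0 f => le_antisymm (hle c hc0 f) (by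
      have := hle c⁻¹ (inv_pos.2 hc0) (c • f)
      rw [inv_smul_smul₀ hc0.ne', ← div_eq_inv_mul, le_div_iff₀' hc0] at this
      exact this))
    (fun f f' => by
      rw [← sub_le_iff_le_add]
      refine le_csInf (hne f) fun C hC => ?_
      rw [sub_le_comm]
      refine le_csInf (hne f') fun C' hC' => ?_
      rw [sub_le_iff_le_add, add_comm]
      obtain ⟨s, hs, h1⟩ := hC
      obtain ⟨s', hs', h1'⟩ := hC'
      rw [add_comm C' C]
      refine csInf_le (hbb _) ⟨s ++ s', fun x hx => ?_, fun g => ?_⟩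
      · rcases List.mem_append.1 hx with h | h
        exacts [hs x h, hs' x h]
      · rw [diffSum_append]
        have := add_le_add (h1 g) (h1' g)
        simp only [Submodule.coe_add, Pi.add_apply]
        linarith)
    (fun x => by
      have hx : x = 0 := by
        obtain ⟨x, hx⟩ := x
        ext1
        exact (Submodule.mem_bot ℝ).1 hx
      subst hx
      rw [LinearPMap.map_zero]
      refine le_csInf (hne _) (hbd _ 0 fun g => le_rfl))
  -- The extension to unbounded functions is arbitrary; it only spares carrying boundedness proofs
  -- in the argument of `Λ`.
  obtain ⟨Λ, hΛ⟩ := LinearMap.exists_extend L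
  have hΛ' : ∀ (f : G → ℝ) (hf : IsBdd f), Λ f = L ⟨f, hf⟩ := fun f hf => by
    rw [← hΛ]
    rfl
  have hdiff : ∀ (f : G → ℝ) (hf : IsBdd f) (a : G), Λ (fun g => f (a * g)) - Λ f ≤ 0 := by
    intro f hf a
    have hf' : IsBdd (fun g => f (a * g)) := hf.comp (a * ·)
    rw [← map_sub, hΛ' _ (hf'.sub hf)]
    refine (hL _).trans (csInf_le (hbb _) ⟨[(a, f)], by simpa using hf, fun g => ?_⟩)
    simp [diffSum]
  refine ⟨Λ, ⟨fun f hf C hC => ?_, fun f hf a => ?_⟩⟩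
  · rw [hΛ' f hf]
    exact (hL _).trans (csInf_le (hbb _) ⟨[], by simp, fun g => by simpa [diffSum] using hC g⟩)
  · have h1 := hdiff f hf a
    have h2 := hdiff (fun g => f (a * g)) (hf.comp (a * ·)) a⁻¹
    simp only [mul_inv_cancel_left] at h2
    linarith

/-- Average over each coset of `N`, then over the quotient. Invariance of the mean on `N` makes the
inner average independent of the representative `q.out`. -/
theorem exists_isInvariantMean_of_quotient {G : Type*} [Group G] (N : Subgroup G) [N.Normal]
    (h1 : ∃ Λ : (N → ℝ) →ₗ[ℝ] ℝ, IsInvariantMean Λ)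
    (h2 : ∃ Λ : (G ⧸ N → ℝ) →ₗ[ℝ] ℝ, IsInvariantMean Λ) :
    ∃ Λ : (G → ℝ) →ₗ[ℝ] ℝ, IsInvariantMean Λ := by
  obtain ⟨A, hA⟩ := h1
  obtain ⟨B, hB⟩ := h2
  let T : (G → ℝ) →ₗ[ℝ] (G ⧸ N → ℝ) :=
    { toFun := fun f q => A (fun n => f (q.out * n))
      map_add' := fun f f' => by
        ext q
        rw [Pi.add_apply, ← map_add]
        rfl
      map_smul' := fun c f => by
        ext q
        rw [Pi.smul_apply, RingHom.id_apply, ← map_smul]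
        rfl }
  have hT : ∀ f, IsBdd f → ∀ g : G, T f (g : G ⧸ N) = A (fun n => f (g * n)) := by
    intro f hf g
    obtain ⟨n₀, hn₀⟩ := QuotientGroup.mk_out_eq_mul N g
    change A _ = _
    rw [hn₀, ← hA.inv (fun n : N => f (g * n)) (hf.comp _) n₀]
    simp [mul_assoc]
  have hTle : ∀ f, IsBdd f → ∀ C, (∀ g, f g ≤ C) → ∀ q, T f q ≤ C := fun f hf C hC q =>
    hA.le _ (hf.comp _) _ fun n => hC _
  have hTb : ∀ f, IsBdd f → IsBdd (T f) := fun f ⟨C, hC⟩ =>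
    ⟨C, fun q => hA.abs_le fun n => hC _⟩
  refine ⟨B ∘ₗ T, ⟨fun f hf C hC => hB.le _ (hTb f hf) _ (hTle f hf C hC), fun f hf a => ?_⟩⟩
  rw [LinearMap.comp_apply, LinearMap.comp_apply, ← hB.inv (T f) (hTb f hf) a]
  congr 1
  ext q
  induction q using QuotientGroup.induction_on with
  | H g =>
    rw [hT (fun g => f (a * g)) (hf.comp (a * ·)), ← QuotientGroup.mk_mul, hT f hf]
    simp [mul_assoc]

/-- A nilpotent group is amenable (as a discrete group). -/
theorem exists_isInvariantMean (G : Type*) [Group G] [Group.IsNilpotent G] :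
    ∃ Λ : (G → ℝ) →ₗ[ℝ] ℝ, IsInvariantMean Λ := by
  refine Group.nilpotent_center_quotient_ind
    (P := fun G _ _ => ∃ Λ : (G → ℝ) →ₗ[ℝ] ℝ, IsInvariantMean Λ) G ?_ ?_
  · intro G _ _
    exact exists_isInvariantMean_of_comm fun a b => Subsingleton.elim _ _
  · intro G _ _ ih
    exact exists_isInvariantMean_of_quotient (Subgroup.center G)
      (exists_isInvariantMean_of_comm fun a b => Subtype.ext (Subgroup.mem_center_iff.1 b.2 a)) ih

end Mean


/-! ### Linear algebra of a generic real subalgebra with a closed positive form -/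

section Algebra

variable {L : Type*} [LieRing L] [LieAlgebra ℂ L]

theorem lie_I_smul (x y : L) : ⁅x, Complex.I • y⁆ = Complex.I • ⁅x, y⁆ := lie_smul _ _ _

theorem I_smul_lie (x y : L) : ⁅Complex.I • x, y⁆ = Complex.I • ⁅x, y⁆ := smul_lie _ _ _

theorem I_smul_I_smul (x : L) : Complex.I • Complex.I • x = -x := by
  rw [smul_smul, Complex.I_mul_I, neg_one_smul]

theorem complex_smul_eq (c : ℂ) (x : L) : c • x = c.re • x + c.im • Complex.I • x := by
  conv_lhs => rw [← Complex.re_add_im c, add_smul, mul_smul]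
  rfl

theorem mem_I_smul_iff {S : Submodule ℝ L} {x : L} :
    x ∈ Complex.I • (S : Set L) ↔ Complex.I • x ∈ S := by
  constructor
  · rintro ⟨y, hy, rfl⟩
    simp only [I_smul_I_smul]
    exact S.neg_mem hy
  · intro h
    refine ⟨-(Complex.I • x), S.neg_mem h, ?_⟩
    simp only [smul_neg, I_smul_I_smul, neg_neg]

theorem exists_add_I_smul {S : Submodule ℝ L}
    (hgen : (S : Set L) + Complex.I • (S : Set L) = Set.univ) (x : L) :
    ∃ a ∈ S, ∃ b ∈ S, x = a + Complex.I • b := by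
  have hx : x ∈ (S : Set L) + Complex.I • (S : Set L) := hgen ▸ Set.mem_univ x
  obtain ⟨a, ha, _, ⟨b, hb, rfl⟩, rfl⟩ := hx
  exact ⟨a, ha, b, hb, rfl⟩

/-- The commutator of a real generic subalgebra spans the commutator over `ℂ`. -/
theorem mem_commutator_decomp {S : Submodule ℝ L}
    (hgen : (S : Set L) + Complex.I • (S : Set L) = Set.univ) {u : L}
    (hu : u ∈ ⁅(⊤ : LieIdeal ℂ L), (⊤ : LieIdeal ℂ L)⁆) :
    ∃ a ∈ Submodule.span ℝ {u | ∃ x ∈ S, ∃ y ∈ S, ⁅x, y⁆ = u},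
      ∃ b ∈ Submodule.span ℝ {u | ∃ x ∈ S, ∃ y ∈ S, ⁅x, y⁆ = u}, u = a + Complex.I • b := by
  set D := Submodule.span ℝ {u : L | ∃ x ∈ S, ∃ y ∈ S, ⁅x, y⁆ = u} with hD
  have hmem : ∀ x ∈ S, ∀ y ∈ S, ⁅x, y⁆ ∈ D := fun x hx y hy =>
    Submodule.subset_span ⟨x, hx, y, hy, rfl⟩
  rw [← LieSubmodule.mem_toSubmodule, LieSubmodule.lieIdeal_oper_eq_linear_span'] at hu
  induction hu using Submodule.span_induction with
  | mem u hu =>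
    obtain ⟨x, -, y, -, rfl⟩ := hu
    obtain ⟨a, ha, b, hb, rfl⟩ := exists_add_I_smul hgen x
    obtain ⟨a', ha', b', hb', rfl⟩ := exists_add_I_smul hgen y
    refine ⟨⁅a, a'⁆ - ⁅b, b'⁆, D.sub_mem (hmem _ ha _ ha') (hmem _ hb _ hb'),
      ⁅a, b'⁆ + ⁅b, a'⁆, D.add_mem (hmem _ ha _ hb') (hmem _ hb _ ha'), ?_⟩
    simp only [add_lie, lie_add, lie_I_smul, I_smul_lie, I_smul_I_smul, smul_add]
    abel
  | zero => exact ⟨0, D.zero_mem, 0, D.zero_mem, by simp⟩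
  | add u v _ _ h1 h2 =>
    obtain ⟨a, ha, b, hb, rfl⟩ := h1
    obtain ⟨a', ha', b', hb', rfl⟩ := h2
    refine ⟨a + a', D.add_mem ha ha', b + b', D.add_mem hb hb', ?_⟩
    rw [smul_add]
    abel
  | smul c u _ h =>
    obtain ⟨a, ha, b, hb, rfl⟩ := h
    refine ⟨c.re • a - c.im • b, D.sub_mem (D.smul_mem _ ha) (D.smul_mem _ hb),
      c.im • a + c.re • b, D.add_mem (D.smul_mem _ ha) (D.smul_mem _ hb), ?_⟩
    rw [complex_smul_eq c (a + Complex.I • b)]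
    simp only [smul_add, I_smul_I_smul, smul_neg, smul_comm Complex.I (_ : ℝ)]
    abel

/-- The algebraic heart: a closed real `2`-form on a generic real subalgebra `S` of a nilpotent
complex Lie algebra, which is positive on complex lines, forces `S ∩ iS` to be central and to
meet the commutator trivially. -/
theorem structure_of_closed_form (S : Submodule ℝ L)
    (hlie : ∀ x ∈ S, ∀ y ∈ S, ⁅x, y⁆ ∈ S)
    (hgen : (S : Set L) + Complex.I • (S : Set L) = Set.univ)
    (β : L → L → ℝ) (hadd : ∀ x y z, β (x + y) z = β x z + β y z)
    (hsmul : ∀ (c : ℝ) x z, β (c • x) z = c * β x z)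
    (hpos : ∀ v, v ≠ 0 → 0 < β v (Complex.I • v))
    (hclosed : ∀ x ∈ S, ∀ y ∈ S, ∀ z ∈ S, β ⁅x, y⁆ z + β ⁅y, z⁆ x + β ⁅z, x⁆ y = 0)
    (V : ℕ → Set L) (hV0 : V 0 = {0}) (hVs : ∀ j, ∀ v ∈ V (j + 1), ∀ x : L, ⁅x, v⁆ ∈ V j)
    (hVn : ∃ n, V n = Set.univ) :
    (∃ 𝔪 : LieIdeal ℂ L, (𝔪 : Set L) = (S : Set L) ∩ Complex.I • (S : Set L) ∧
      𝔪 ≤ LieAlgebra.center ℂ L ∧ 𝔪 ⊓ ⁅(⊤ : LieIdeal ℂ L), (⊤ : LieIdeal ℂ L)⁆ = ⊥) ∧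
    (LieAlgebra.center ℂ L : Set L) =
      {x | x ∈ (S : Set L) ∧ ∀ y ∈ (S : Set L), ⁅x, y⁆ = 0} +
        Complex.I • {x | x ∈ (S : Set L) ∧ ∀ y ∈ (S : Set L), ⁅x, y⁆ = 0} := by
  have hβ0 : ∀ z, β 0 z = 0 := fun z => by simpa using hsmul 0 0 z
  set D := Submodule.span ℝ {u : L | ∃ x ∈ S, ∃ y ∈ S, ⁅x, y⁆ = u} with hD
  have hDS : D ≤ S := Submodule.span_le.2 (by rintro _ ⟨x, hx, y, hy, rfl⟩; exact hlie x hx y hy)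
  -- commutators are orthogonal to central elements
  have horth : ∀ z ∈ S, (∀ x : L, ⁅x, z⁆ = 0) → ∀ u ∈ D, β u z = 0 := by
    intro z hz hc u hu
    induction hu using Submodule.span_induction with
    | mem u hu =>
      obtain ⟨x, hx, y, hy, rfl⟩ := hu
      have := hclosed x hx y hy z hz
      rwa [hc y, ← lie_skew z x, hc x, neg_zero, hβ0, hβ0, add_zero, add_zero] at this
    | zero => exact hβ0 z
    | add u v _ _ h1 h2 => rw [hadd, h1, h2, add_zero]
    | smul c u _ h => rw [hsmul, h, mul_zero]
  -- `I • u` is a central element of `S`, so it is orthogonal to `u`, against positivity.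
  have hzero : ∀ u ∈ D, Complex.I • u ∈ S → (∀ x : L, ⁅x, u⁆ = 0) → u = 0 := by
    intro u hu hIu hc
    by_contra hne
    refine (hpos u hne).ne' (horth _ hIu (fun x => ?_) u hu)
    rw [lie_I_smul, hc, smul_zero]
  have hcent : ∀ v : L, (∀ x ∈ S, ⁅x, v⁆ = 0) → ∀ x : L, ⁅x, v⁆ = 0 := by
    intro v hv x
    obtain ⟨a, ha, b, hb, rfl⟩ := exists_add_I_smul hgen x
    rw [add_lie, I_smul_lie, hv a ha, hv b hb, smul_zero, add_zero]
  -- Bracketing with `x ∈ S` preserves `S ∩ iS` and lowers the filtration index, so the bracket is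
  -- central by induction; being in `D`, it is zero by `hzero`.
  have hm : ∀ j, ∀ v ∈ V j, v ∈ S → Complex.I • v ∈ S → ∀ x : L, ⁅x, v⁆ = 0 := by
    intro j
    induction j with
    | zero =>
      intro v hv _ _ x
      rw [hV0] at hv
      rw [Set.mem_singleton_iff.1 hv, lie_zero]
    | succ j ih =>
      intro v hv hvS hIvS
      refine hcent v fun x hx => ?_
      have h1 : ⁅x, v⁆ ∈ S := hlie x hx v hvS
      have h2 : Complex.I • ⁅x, v⁆ ∈ S := by
        rw [← lie_I_smul]
        exact hlie x hx _ hIvS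
      exact hzero _ (Submodule.subset_span ⟨x, hx, v, hvS, rfl⟩) h2 (ih _ (hVs j v hv x) h1 h2)
  have hmc : ∀ v ∈ S, Complex.I • v ∈ S → ∀ x : L, ⁅x, v⁆ = 0 := by
    obtain ⟨n, hn⟩ := hVn
    exact fun v => hm n v (hn ▸ Set.mem_univ v)
  -- Writing `u = a + I • b` with `a, b ∈ D ⊆ S`, membership of `u` and `I • u` in `S` puts both `a`
  -- and `b` in `S ∩ iS`.
  have hmD : ∀ u ∈ S, Complex.I • u ∈ S →
      u ∈ ⁅(⊤ : LieIdeal ℂ L), (⊤ : LieIdeal ℂ L)⁆ → u = 0 := by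
    intro u hu hIu huD
    obtain ⟨a, ha, b, hb, rfl⟩ := mem_commutator_decomp hgen huD
    have hIb : Complex.I • b ∈ S := by simpa using S.sub_mem hu (hDS ha)
    have hIa : Complex.I • a ∈ S := by
      rw [smul_add, I_smul_I_smul] at hIu
      simpa using S.add_mem hIu (hDS hb)
    rw [hzero a ha hIa (hmc a (hDS ha) hIa), hzero b hb hIb (hmc b (hDS hb) hIb), smul_zero,
      add_zero]
  have hmem : ∀ x, x ∈ (S : Set L) ∩ Complex.I • (S : Set L) ↔ x ∈ S ∧ Complex.I • x ∈ S := by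
    intro x
    rw [Set.mem_inter_iff, mem_I_smul_iff, SetLike.mem_coe]
  refine ⟨⟨{ carrier := (S : Set L) ∩ Complex.I • (S : Set L)
             add_mem' := ?_, zero_mem' := ?_, smul_mem' := ?_, lie_mem := ?_ }, rfl, ?_, ?_⟩, ?_⟩
  · intro a b ha hb
    rw [hmem] at *
    exact ⟨S.add_mem ha.1 hb.1, by rw [smul_add]; exact S.add_mem ha.2 hb.2⟩
  · rw [hmem]
    simp
  · intro c x hx
    rw [hmem] at *
    rw [complex_smul_eq c x, smul_add, smul_comm Complex.I (_ : ℝ), smul_comm Complex.I (_ : ℝ),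
      I_smul_I_smul]
    exact ⟨S.add_mem (S.smul_mem _ hx.1) (S.smul_mem _ hx.2),
      S.add_mem (S.smul_mem _ hx.2) (S.smul_mem _ (S.neg_mem hx.1))⟩
  · intro x v hv
    change v ∈ (S : Set L) ∩ Complex.I • (S : Set L) at hv
    rw [hmem] at *
    rw [hmc v hv.1 hv.2 x]
    simp
  · intro v hv
    change v ∈ (S : Set L) ∩ Complex.I • (S : Set L) at hv
    rw [hmem] at hv
    rw [LieModule.mem_maxTrivSubmodule]
    exact hmc v hv.1 hv.2
  · rw [eq_bot_iff]
    rintro v ⟨hv, hv'⟩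
    change v ∈ (S : Set L) ∩ Complex.I • (S : Set L) at hv
    rw [hmem] at hv
    exact (LieSubmodule.mem_bot v).2 (hmD v hv.1 hv.2 hv')
  · ext z
    rw [SetLike.mem_coe, LieModule.mem_maxTrivSubmodule]
    constructor
    · intro hz
      obtain ⟨a, ha, b, hb, rfl⟩ := exists_add_I_smul hgen z
      -- Centrality gives `I • ⁅b, y⁆ = -⁅a, y⁆ ∈ S`, so `⁅b, y⁆` lies in `S ∩ iS` and in the
      -- commutator.
      have key : ∀ y ∈ S, ⁅a, y⁆ = 0 ∧ ⁅b, y⁆ = 0 := by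
        intro y hy
        have h0 : ⁅a, y⁆ + Complex.I • ⁅b, y⁆ = 0 := by
          rw [← I_smul_lie, ← add_lie, ← lie_skew, hz y, neg_zero]
        have h1 : ⁅b, y⁆ = 0 := by
          refine hmD _ (hlie b hb y hy) ?_ (LieSubmodule.lie_mem_lie trivial trivial)
          rw [eq_neg_of_add_eq_zero_right h0]
          exact S.neg_mem (hlie a ha y hy)
        rw [h1, smul_zero, add_zero] at h0
        exact ⟨h0, h1⟩
      exact ⟨a, ⟨ha, fun y hy => (key y hy).1⟩, _, ⟨b, ⟨hb, fun y hy => (key y hy).2⟩, rfl⟩, rfl⟩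
    · rintro ⟨a, ⟨ha, ha'⟩, _, ⟨b, ⟨hb, hb'⟩, rfl⟩, rfl⟩
      refine hcent _ fun x hx => ?_
      change ⁅x, a + Complex.I • b⁆ = 0
      rw [lie_add, lie_I_smul, ← lie_skew, ha' x hx, ← lie_skew, hb' x hx]
      simp

end Algebra


/-! ### The group law and the invariant vector fields in the chart at the identity -/

section Coord

variable {E : Type*} [NormedAddCommGroup E]
  {G : Type*} [TopologicalSpace G] [ChartedSpace E G] [Group G]

variable (E G) in
/-- The coordinate of the identity in the preferred chart at the identity. -/
noncomputable def baseCoord : E := chartAt E (1 : G) 1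

variable (E G) in
/-- The multiplication, read in the preferred chart at the identity. -/
noncomputable def coordMul (p : E × E) : E :=
  chartAt E (1 : G) ((chartAt E (1 : G)).symm p.1 * (chartAt E (1 : G)).symm p.2)

theorem baseCoord_mem : baseCoord E G ∈ (chartAt E (1 : G)).target :=
  (chartAt E (1 : G)).map_source (mem_chart_source E 1)

@[simp]
theorem chart_symm_baseCoord : (chartAt E (1 : G)).symm (baseCoord E G) = 1 :=
  (chartAt E (1 : G)).left_inv (mem_chart_source E 1)

theorem baseCoord_def : chartAt E (1 : G) 1 = baseCoord E G := rfl

theorem continuousAt_chart_symm_base :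
    ContinuousAt (chartAt E (1 : G)).symm (baseCoord E G) :=
  (chartAt E (1 : G)).continuousAt_symm baseCoord_mem

theorem eventually_chart_right_inv :
    ∀ᶠ x in 𝓝 (baseCoord E G), chartAt E (1 : G) ((chartAt E (1 : G)).symm x) = x := by
  filter_upwards [(chartAt E (1 : G)).open_target.mem_nhds baseCoord_mem] with x hx
  exact (chartAt E (1 : G)).right_inv hx

theorem eventually_chart_left_inv :
    ∀ᶠ x in 𝓝 (1 : G), (chartAt E (1 : G)).symm (chartAt E (1 : G) x) = x := by
  filter_upwards [(chartAt E (1 : G)).open_source.mem_nhds (mem_chart_source E (1 : G))] with x hx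
  exact (chartAt E (1 : G)).left_inv hx

theorem coordMul_base_right :
    ∀ᶠ x in 𝓝 (baseCoord E G), coordMul E G (x, baseCoord E G) = x := by
  filter_upwards [eventually_chart_right_inv (E := E) (G := G)] with x hx
  simpa [coordMul] using hx

theorem coordMul_base_left :
    ∀ᶠ x in 𝓝 (baseCoord E G), coordMul E G (baseCoord E G, x) = x := by
  filter_upwards [eventually_chart_right_inv (E := E) (G := G)] with x hx
  simpa [coordMul] using hx

@[simp]
theorem coordMul_base : coordMul E G (baseCoord E G, baseCoord E G) = baseCoord E G := by
  simp [coordMul, baseCoord_def]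

theorem eventually_symm_coordMul [ContinuousMul G] :
    ∀ᶠ p : E × E in 𝓝 (baseCoord E G, baseCoord E G),
      (chartAt E (1 : G)).symm (coordMul E G p) =
        (chartAt E (1 : G)).symm p.1 * (chartAt E (1 : G)).symm p.2 := by
  have h1 : ContinuousAt (fun p : E × E => (chartAt E (1 : G)).symm p.1)
      (baseCoord E G, baseCoord E G) :=
    ContinuousAt.comp (f := Prod.fst) continuousAt_chart_symm_base continuousAt_fst
  have h2 : ContinuousAt (fun p : E × E => (chartAt E (1 : G)).symm p.2)
      (baseCoord E G, baseCoord E G) :=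
    ContinuousAt.comp (f := Prod.snd) continuousAt_chart_symm_base continuousAt_snd
  have h3 := h1.mul h2
  have h4 := h3.eventually (p := fun x => (chartAt E (1 : G)).symm (chartAt E (1 : G) x) = x)
    (by simpa using eventually_chart_left_inv)
  filter_upwards [h4] with p hp using hp

section Smooth

variable [NormedSpace ℂ E]

variable (E G) in
/-- The left invariant vector fields, read in the preferred chart at the identity. -/
noncomputable def leftField (x : E) : E →L[ℂ] E :=
  (fderiv ℂ (coordMul E G) (x, baseCoord E G)).comp (ContinuousLinearMap.inr ℂ E E)

variable (E G) in
/-- The right invariant vector fields, read in the preferred chart at the identity. -/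
noncomputable def rightField (y : E) : E →L[ℂ] E :=
  (fderiv ℂ (coordMul E G) (baseCoord E G, y)).comp (ContinuousLinearMap.inl ℂ E E)

variable [LieGroup 𝓘(ℂ, E) ω G]

theorem contMDiffAt_chart_symm_of_mem {a : G} {x : E} (hx : x ∈ (chartAt E a).target) :
    ContMDiffAt 𝓘(ℂ, E) 𝓘(ℂ, E) ω (chartAt E a).symm x :=
  (contMDiffOn_chart_symm (I := 𝓘(ℂ, E)) (n := ω) (x := a)).contMDiffAt
    ((chartAt E a).open_target.mem_nhds hx)

theorem contMDiffAt_chart_of_mem {a x : G} (hx : x ∈ (chartAt E a).source) :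
    ContMDiffAt 𝓘(ℂ, E) 𝓘(ℂ, E) ω (chartAt E a) x :=
  (contMDiffOn_chart (I := 𝓘(ℂ, E)) (n := ω) (x := a)).contMDiffAt
    ((chartAt E a).open_source.mem_nhds hx)

/-- The multiplication, read in any charts, is analytic. -/
theorem contDiffAt_chart_mul (a b d : G) {p : E × E} (h1 : p.1 ∈ (chartAt E a).target)
    (h2 : p.2 ∈ (chartAt E b).target)
    (h3 : (chartAt E a).symm p.1 * (chartAt E b).symm p.2 ∈ (chartAt E d).source) :
    ContDiffAt ℂ ω
      (fun p : E × E => chartAt E d ((chartAt E a).symm p.1 * (chartAt E b).symm p.2)) p := by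
  rw [← contMDiffAt_iff_contDiffAt]
  have k1 : ContMDiffAt 𝓘(ℂ, E × E) 𝓘(ℂ, E) ω (fun p : E × E => (chartAt E a).symm p.1) p :=
    (contMDiffAt_chart_symm_of_mem h1).comp p (contDiff_fst.contMDiff.contMDiffAt)
  have k2 : ContMDiffAt 𝓘(ℂ, E × E) 𝓘(ℂ, E) ω (fun p : E × E => (chartAt E b).symm p.2) p :=
    (contMDiffAt_chart_symm_of_mem h2).comp p (contDiff_snd.contMDiff.contMDiffAt)
  exact ContMDiffAt.comp p (g := chartAt E d) (contMDiffAt_chart_of_mem h3) (k1.mul k2)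

theorem contDiffAt_coordMul : ContDiffAt ℂ ω (coordMul E G) (baseCoord E G, baseCoord E G) :=
  contDiffAt_chart_mul 1 1 1 baseCoord_mem baseCoord_mem (by simp)

theorem eventually_contDiffAt_coordMul :
    ∀ᶠ p in 𝓝 (baseCoord E G, baseCoord E G), ContDiffAt ℂ ω (coordMul E G) p :=
  contDiffAt_coordMul.eventually (by simp)

theorem contDiffAt_fderiv_coordMul :
    ContDiffAt ℂ ω (fderiv ℂ (coordMul E G)) (baseCoord E G, baseCoord E G) :=
  contDiffAt_coordMul.fderiv_right (m := ω) (by simp)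

theorem contDiffAt_leftField : ContDiffAt ℂ ω (leftField E G) (baseCoord E G) :=
  (ContDiffAt.comp (f := fun x => (x, baseCoord E G)) (baseCoord E G) contDiffAt_fderiv_coordMul
    (contDiffAt_id.prodMk contDiffAt_const)).clm_comp contDiffAt_const

theorem contDiffAt_rightField : ContDiffAt ℂ ω (rightField E G) (baseCoord E G) :=
  (ContDiffAt.comp (f := fun x => (baseCoord E G, x)) (baseCoord E G) contDiffAt_fderiv_coordMul
    (contDiffAt_const.prodMk contDiffAt_id)).clm_comp contDiffAt_const

theorem eventually_hasFDerivAt_leftField :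
    ∀ᶠ x in 𝓝 (baseCoord E G),
      HasFDerivAt (fun y => coordMul E G (x, y)) (leftField E G x) (baseCoord E G) := by
  have h : Filter.Tendsto (fun x : E => (x, baseCoord E G)) (𝓝 (baseCoord E G))
      (𝓝 (baseCoord E G, baseCoord E G)) :=
    Continuous.tendsto (by fun_prop) _
  filter_upwards [h.eventually (eventually_contDiffAt_coordMul (E := E) (G := G))] with x hx
  exact HasFDerivAt.comp (f := fun y => (x, y)) (baseCoord E G)
    (hx.differentiableAt (by simp)).hasFDerivAt (hasFDerivAt_prodMk_right x (baseCoord E G))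

theorem eventually_hasFDerivAt_rightField :
    ∀ᶠ y in 𝓝 (baseCoord E G),
      HasFDerivAt (fun x => coordMul E G (x, y)) (rightField E G y) (baseCoord E G) := by
  have h : Filter.Tendsto (fun x : E => (baseCoord E G, x)) (𝓝 (baseCoord E G))
      (𝓝 (baseCoord E G, baseCoord E G)) :=
    Continuous.tendsto (by fun_prop) _
  filter_upwards [h.eventually (eventually_contDiffAt_coordMul (E := E) (G := G))] with x hx
  exact HasFDerivAt.comp (f := fun y => (y, x)) (baseCoord E G)
    (hx.differentiableAt (by simp)).hasFDerivAt (hasFDerivAt_prodMk_left (baseCoord E G) x)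

theorem leftField_base : leftField E G (baseCoord E G) = ContinuousLinearMap.id ℂ E :=
  (eventually_hasFDerivAt_leftField (E := E) (G := G)).self_of_nhds.unique
    ((hasFDerivAt_id _).congr_of_eventuallyEq coordMul_base_left)

theorem rightField_base : rightField E G (baseCoord E G) = ContinuousLinearMap.id ℂ E :=
  (eventually_hasFDerivAt_rightField (E := E) (G := G)).self_of_nhds.unique
    ((hasFDerivAt_id _).congr_of_eventuallyEq coordMul_base_right)

theorem hasFDerivAt_coordMul :
    HasFDerivAt (coordMul E G) (ContinuousLinearMap.fst ℂ E E + ContinuousLinearMap.snd ℂ E E)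
      (baseCoord E G, baseCoord E G) := by
  have h := (contDiffAt_coordMul (E := E) (G := G)).differentiableAt (by simp) |>.hasFDerivAt
  suffices H : ContinuousLinearMap.fst ℂ E E + ContinuousLinearMap.snd ℂ E E =
      fderiv ℂ (coordMul E G) (baseCoord E G, baseCoord E G) by rwa [H]
  refine ContinuousLinearMap.ext fun p => ?_
  obtain ⟨v, w⟩ := p
  have h1 := congrArg (fun A => A v) (rightField_base (E := E) (G := G))
  have h2 := congrArg (fun A => A w) (leftField_base (E := E) (G := G))
  simp only [rightField, leftField, ContinuousLinearMap.comp_apply, ContinuousLinearMap.inl_apply,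
    ContinuousLinearMap.inr_apply, ContinuousLinearMap.id_apply] at h1 h2
  have : ((v, w) : E × E) = (v, 0) + (0, w) := by simp
  rw [this, map_add, map_add, h1, h2]
  simp

theorem fderiv_leftField_apply (v w : E) :
    fderiv ℂ (leftField E G) (baseCoord E G) v w =
      fderiv ℂ (fderiv ℂ (coordMul E G)) (baseCoord E G, baseCoord E G) (v, 0) (0, w) := by
  have h := (contDiffAt_fderiv_coordMul (E := E) (G := G)).differentiableAt (by simp)
    |>.hasFDerivAt
  have h1 : HasFDerivAt (fun x : E => fderiv ℂ (coordMul E G) (x, baseCoord E G)) _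
    (baseCoord E G) := HasFDerivAt.comp (f := fun e => (e, baseCoord E G)) (baseCoord E G) h
      (hasFDerivAt_prodMk_left (baseCoord E G) _)
  have h2 := h1.clm_comp (hasFDerivAt_const (ContinuousLinearMap.inr ℂ E E) (baseCoord E G))
  rw [HasFDerivAt.fderiv (f := leftField E G) h2]
  simp

/-- Both sides are mixed second derivatives of the multiplication, with the two slots exchanged;
second derivatives are symmetric. -/
theorem fderiv_rightField_apply (v w : E) :
    fderiv ℂ (rightField E G) (baseCoord E G) v w =
      fderiv ℂ (leftField E G) (baseCoord E G) w v := by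
  have h := (contDiffAt_fderiv_coordMul (E := E) (G := G)).differentiableAt (by simp)
    |>.hasFDerivAt
  have h1 : HasFDerivAt (fun x : E => fderiv ℂ (coordMul E G) (baseCoord E G, x)) _
    (baseCoord E G) := HasFDerivAt.comp (f := fun e => (baseCoord E G, e)) (baseCoord E G) h
      (hasFDerivAt_prodMk_right _ (baseCoord E G))
  have h2 := h1.clm_comp (hasFDerivAt_const (ContinuousLinearMap.inl ℂ E E) (baseCoord E G))
  rw [HasFDerivAt.fderiv (f := rightField E G) h2, fderiv_leftField_apply,
    (contDiffAt_coordMul (E := E) (G := G)).isSymmSndFDerivAt_of_omega (w, 0) (0, v)]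
  simp

end Smooth

end Coord

/-! ### The Lie bracket as an antisymmetrized second derivative -/

variable {E : Type*} [NormedAddCommGroup E]
  {G : Type*} [TopologicalSpace G] [ChartedSpace E G] [Group G] [NormedSpace ℂ E]

theorem hasMFDerivAt_chart_symm_base :
    HasMFDerivAt 𝓘(ℂ, E) 𝓘(ℂ, E) (chartAt E (1 : G)).symm (baseCoord E G)
      (ContinuousLinearMap.id ℂ E) := by
  refine ⟨continuousAt_chart_symm_base, ?_⟩
  have h : ∀ᶠ x in 𝓝 (baseCoord E G),
      chartAt E (1 : G) ((chartAt E (1 : G)).symm x) = x := eventually_chart_right_inv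
  simp only [mfld_simps, chart_symm_baseCoord]
  exact (HasFDerivAt.congr_of_eventuallyEq
    (hasFDerivAt_id (𝕜 := ℂ) (baseCoord E G)) h).hasFDerivWithinAt

theorem hasMFDerivAt_chart_base :
    HasMFDerivAt 𝓘(ℂ, E) 𝓘(ℂ, E) (chartAt E (1 : G)) 1 (ContinuousLinearMap.id ℂ E) := by
  refine ⟨(chartAt E (1 : G)).continuousAt (mem_chart_source E 1), ?_⟩
  have h : ∀ᶠ x in 𝓝 (baseCoord E G),
      chartAt E (1 : G) ((chartAt E (1 : G)).symm x) = x := eventually_chart_right_inv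
  simp only [mfld_simps]
  exact (HasFDerivAt.congr_of_eventuallyEq
    (hasFDerivAt_id (𝕜 := ℂ) (baseCoord E G)) h).hasFDerivWithinAt

variable [LieGroup 𝓘(ℂ, E) ω G]

/-- Differentiate the coordinate expression of `x * y` in `y` at the identity. This matches
`leftField` with the invariant fields that define the bracket. -/
theorem mfderiv_chart_symm_leftField :
    ∀ᶠ x in 𝓝 (baseCoord E G), ∀ v : E,
      (mfderiv 𝓘(ℂ, E) 𝓘(ℂ, E) (chartAt E (1 : G)).symm x : E →L[ℂ] E) (leftField E G x v) =
        mulInvariantVectorField (I := 𝓘(ℂ, E)) (G := G) v ((chartAt E (1 : G)).symm x) := by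
  have : ContinuousMul G := continuousMul_of_contMDiffMul 𝓘(ℂ, E) ω
  have h := (eventually_symm_coordMul (E := E) (G := G))
  rw [nhds_prod_eq] at h
  filter_upwards [h.curry, eventually_hasFDerivAt_leftField (E := E) (G := G),
    coordMul_base_right (E := E) (G := G),
    (chartAt E (1 : G)).open_target.mem_nhds baseCoord_mem] with x hx hl hb hxt v
  have h1 : HasMFDerivAt 𝓘(ℂ, E) 𝓘(ℂ, E)
      (fun y => (chartAt E (1 : G)).symm (coordMul E G (x, y))) (baseCoord E G)
      ((mfderiv 𝓘(ℂ, E) 𝓘(ℂ, E) (chartAt E (1 : G)).symm x : E →L[ℂ] E).comp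
        (leftField E G x)) := by
    have := (contMDiffAt_chart_symm_of_mem hxt).mdifferentiableAt (by simp) |>.hasMFDerivAt
    refine HasMFDerivAt.comp (f := fun y => coordMul E G (x, y)) (baseCoord E G) ?_ hl.hasMFDerivAt
    rw [hb]
    exact this
  have h2 : HasMFDerivAt 𝓘(ℂ, E) 𝓘(ℂ, E)
      (fun y => (chartAt E (1 : G)).symm x * (chartAt E (1 : G)).symm y) (baseCoord E G)
      ((mfderiv 𝓘(ℂ, E) 𝓘(ℂ, E) (fun y => (chartAt E (1 : G)).symm x * y) (1 : G) : E →L[ℂ] E).comp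
        (ContinuousLinearMap.id ℂ E)) := by
    refine HasMFDerivAt.comp (f := (chartAt E (1 : G)).symm) (baseCoord E G) ?_
      hasMFDerivAt_chart_symm_base
    rw [chart_symm_baseCoord]
    exact ((contMDiff_mul_left (I := 𝓘(ℂ, E)) (n := ω)).contMDiffAt.mdifferentiableAt
      (by simp)).hasMFDerivAt
  have h3 := hasMFDerivAt_unique h1 (h2.congr_of_eventuallyEq hx)
  exact congrArg (fun A : E →L[ℂ] E => A v) h3

theorem eventually_mpullback_mulInvariantVectorField (v : E) :
    ∀ᶠ x in 𝓝 (baseCoord E G),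
      VectorField.mpullbackWithin 𝓘(ℂ, E) 𝓘(ℂ, E) (extChartAt 𝓘(ℂ, E) (1 : G)).symm
        (mulInvariantVectorField (I := 𝓘(ℂ, E)) (G := G) v) (Set.range 𝓘(ℂ, E)) x =
      leftField E G x v := by
  have hI : IsManifold 𝓘(ℂ, E) 1 G := IsManifold.of_le (n := ω) (by simp)
  filter_upwards [mfderiv_chart_symm_leftField (E := E) (G := G),
    (chartAt E (1 : G)).open_target.mem_nhds baseCoord_mem] with x hx hxt
  have hinv := isInvertible_mfderivWithin_extChartAt_symm (I := 𝓘(ℂ, E)) (x := (1 : G)) (y := x)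
    (by simpa using hxt)
  rw [VectorField.mpullbackWithin_apply]
  have h1 : mulInvariantVectorField (I := 𝓘(ℂ, E)) (G := G) v
      ((extChartAt 𝓘(ℂ, E) (1 : G)).symm x) =
      mfderivWithin 𝓘(ℂ, E) 𝓘(ℂ, E) (extChartAt 𝓘(ℂ, E) (1 : G)).symm (Set.range 𝓘(ℂ, E)) x
        (leftField E G x v) := by
    have h2 : mfderivWithin 𝓘(ℂ, E) 𝓘(ℂ, E) (extChartAt 𝓘(ℂ, E) (1 : G)).symm
        (Set.range 𝓘(ℂ, E)) x = mfderiv 𝓘(ℂ, E) 𝓘(ℂ, E) (chartAt E (1 : G)).symm x := by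
      simp only [mfld_simps, mfderivWithin_univ]
      rfl
    rw [h2]
    exact (hx v).symm
  rw [h1]
  exact hinv.inverse_apply_self _

theorem lieBracket_leftField (v w : E) :
    VectorField.lieBracket ℂ (fun x => leftField E G x v) (fun x => leftField E G x w)
      (baseCoord E G) =
      fderiv ℂ (leftField E G) (baseCoord E G) v w -
        fderiv ℂ (leftField E G) (baseCoord E G) w v := by
  have h3 : ∀ u : E, HasFDerivAt (fun x => leftField E G x u)
      ((ContinuousLinearMap.apply ℂ E u).comp (fderiv ℂ (leftField E G) (baseCoord E G)))
      (baseCoord E G) := fun u =>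
    (ContinuousLinearMap.apply ℂ E u).hasFDerivAt.comp (baseCoord E G)
      ((contDiffAt_leftField (E := E) (G := G)).differentiableAt (by simp)).hasFDerivAt
  rw [VectorField.lieBracket, (h3 v).fderiv, (h3 w).fderiv, leftField_base]
  rfl

/-- The chart at `1` has identity derivative there, so the bracket can be computed on the coordinate
fields `leftField`, which are themselves the identity at the base point. -/
theorem bracket_eq_sub (v w : GroupLieAlgebra 𝓘(ℂ, E) G) :
    (⁅v, w⁆ : GroupLieAlgebra 𝓘(ℂ, E) G) =
      fderiv ℂ (leftField E G) (baseCoord E G) v w -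
        fderiv ℂ (leftField E G) (baseCoord E G) w v := by
  rw [GroupLieAlgebra.bracket_def, VectorField.mlieBracket, VectorField.mlieBracketWithin_apply]
  have h1 : mfderiv 𝓘(ℂ, E) 𝓘(ℂ, E) (extChartAt 𝓘(ℂ, E) (1 : G)) 1 =
      (ContinuousLinearMap.id ℂ E) := by
    have := (hasMFDerivAt_chart_base (E := E) (G := G)).mfderiv
    simp only [mfld_simps]
    exact this
  have h2 : extChartAt 𝓘(ℂ, E) (1 : G) 1 = baseCoord E G := by simp [baseCoord_def]
  have hset : (extChartAt 𝓘(ℂ, E) (1 : G)).symm ⁻¹' Set.univ ∩ Set.range 𝓘(ℂ, E) = Set.univ := by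
    simp
  have h4 : ContinuousLinearMap.inverse (ContinuousLinearMap.id ℂ E) =
    ContinuousLinearMap.id ℂ E := ContinuousLinearMap.inverse_id
  have h5 := (congrFun VectorField.lieBracketWithin_univ _).trans
    (Filter.EventuallyEq.lieBracket_vectorField_eq (𝕜 := ℂ)
      (eventually_mpullback_mulInvariantVectorField (E := E) (G := G) v)
      (eventually_mpullback_mulInvariantVectorField (E := E) (G := G) w))
  rw [← hset, ← h2] at h5
  refine (congrArg (fun A : E →L[ℂ] E => ContinuousLinearMap.inverse A _) h1).trans ?_
  refine (congrArg (fun A : E →L[ℂ] E => A _) h4).trans ?_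
  refine h5.trans ?_
  rw [h2]
  exact lieBracket_leftField (E := E) (G := G) v w


/-! ### The adjoint action and its derivative at the identity -/

section Adjoint

variable {E : Type*} [NormedAddCommGroup E]
  {G : Type*} [TopologicalSpace G] [ChartedSpace E G] [Group G]

variable (E G) in
/-- The conjugation, read in the preferred chart at the identity. -/
noncomputable def coordConj (p : E × E) : E :=
  chartAt E (1 : G) ((chartAt E (1 : G)).symm p.1 * (chartAt E (1 : G)).symm p.2 *
    ((chartAt E (1 : G)).symm p.1)⁻¹)

theorem coordConj_base (x : E) : coordConj E G (x, baseCoord E G) = baseCoord E G := by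
  simp [coordConj, baseCoord_def]

variable [NormedSpace ℂ E]

variable (E) in
/-- The adjoint action of the Lie group `G` on its Lie algebra. -/
noncomputable def adjoint (g : G) : E →L[ℂ] E :=
  fderiv ℂ (fun y => chartAt E (1 : G) (g * (chartAt E (1 : G)).symm y * g⁻¹)) (baseCoord E G)

variable (E G) in
/-- The adjoint action, read in the preferred chart at the identity. -/
noncomputable def coordAdjoint (x : E) : E →L[ℂ] E :=
  (fderiv ℂ (coordConj E G) (x, baseCoord E G)).comp (ContinuousLinearMap.inr ℂ E E)

variable [LieGroup 𝓘(ℂ, E) ω G]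

theorem hasFDerivAt_adjoint (g : G) :
    HasFDerivAt (fun y => chartAt E (1 : G) (g * (chartAt E (1 : G)).symm y * g⁻¹)) (adjoint E g)
      (baseCoord E G) := by
  refine DifferentiableAt.hasFDerivAt (ContDiffAt.differentiableAt (n := ω) ?_ (by simp))
  rw [← contMDiffAt_iff_contDiffAt]
  refine ContMDiffAt.comp (baseCoord E G) (g := chartAt E (1 : G))
    (contMDiffAt_chart_of_mem (by simp))
    ((contMDiffAt_const.mul (contMDiffAt_chart_symm_of_mem baseCoord_mem)).mul contMDiffAt_const)

theorem contDiffAt_coordConj : ContDiffAt ℂ ω (coordConj E G) (baseCoord E G, baseCoord E G) := by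
  rw [← contMDiffAt_iff_contDiffAt]
  have k1 : ContMDiffAt 𝓘(ℂ, E × E) 𝓘(ℂ, E) ω (fun p : E × E => (chartAt E (1 : G)).symm p.1)
      (baseCoord E G, baseCoord E G) :=
    ContMDiffAt.comp (f := Prod.fst) _ (contMDiffAt_chart_symm_of_mem baseCoord_mem)
      (contDiff_fst.contMDiff.contMDiffAt)
  have k2 : ContMDiffAt 𝓘(ℂ, E × E) 𝓘(ℂ, E) ω (fun p : E × E => (chartAt E (1 : G)).symm p.2)
      (baseCoord E G, baseCoord E G) :=
    ContMDiffAt.comp (f := Prod.snd) _ (contMDiffAt_chart_symm_of_mem baseCoord_mem)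
      (contDiff_snd.contMDiff.contMDiffAt)
  exact ContMDiffAt.comp _ (g := chartAt E (1 : G)) (contMDiffAt_chart_of_mem (by simp))
    ((k1.mul k2).mul k1.inv)

theorem contDiffAt_coordAdjoint : ContDiffAt ℂ ω (coordAdjoint E G) (baseCoord E G) :=
  (ContDiffAt.comp (f := fun x => (x, baseCoord E G)) (baseCoord E G)
    (contDiffAt_coordConj.fderiv_right (m := ω) (by simp))
    (contDiffAt_id.prodMk contDiffAt_const)).clm_comp contDiffAt_const

theorem eventually_hasFDerivAt_coordAdjoint :
    ∀ᶠ x in 𝓝 (baseCoord E G),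
      HasFDerivAt (fun y => coordConj E G (x, y)) (coordAdjoint E G x) (baseCoord E G) := by
  have h : Filter.Tendsto (fun x : E => (x, baseCoord E G)) (𝓝 (baseCoord E G))
      (𝓝 (baseCoord E G, baseCoord E G)) :=
    Continuous.tendsto (by fun_prop) _
  filter_upwards [h.eventually ((contDiffAt_coordConj (E := E) (G := G)).eventually (by simp))]
    with x hx
  exact HasFDerivAt.comp (f := fun y => (x, y)) (baseCoord E G)
    (hx.differentiableAt (by simp)).hasFDerivAt (hasFDerivAt_prodMk_right x (baseCoord E G))

theorem eventually_adjoint_eq :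
    ∀ᶠ x in 𝓝 (baseCoord E G), adjoint E ((chartAt E (1 : G)).symm x) = coordAdjoint E G x := by
  filter_upwards [eventually_hasFDerivAt_coordAdjoint (E := E) (G := G)] with x hx
  exact hx.fderiv

/-- This is `(x * y * x⁻¹) * x = x * y`. Differentiating it relates the adjoint action to the
invariant fields without differentiating inversion. -/
theorem eventually_coordMul_coordConj :
    ∀ᶠ p : E × E in 𝓝 (baseCoord E G, baseCoord E G),
      coordMul E G (coordConj E G p, p.1) = coordMul E G p := by
  have h1 : ContinuousAt (fun p : E × E => (chartAt E (1 : G)).symm p.1 *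
      (chartAt E (1 : G)).symm p.2 * ((chartAt E (1 : G)).symm p.1)⁻¹)
      (baseCoord E G, baseCoord E G) := by
    have : IsTopologicalGroup G := topologicalGroup_of_lieGroup 𝓘(ℂ, E) ω
    have h1 : ContinuousAt (fun p : E × E => (chartAt E (1 : G)).symm p.1)
        (baseCoord E G, baseCoord E G) :=
      ContinuousAt.comp (f := Prod.fst) continuousAt_chart_symm_base continuousAt_fst
    have h2 : ContinuousAt (fun p : E × E => (chartAt E (1 : G)).symm p.2)
        (baseCoord E G, baseCoord E G) :=
      ContinuousAt.comp (f := Prod.snd) continuousAt_chart_symm_base continuousAt_snd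
    exact (h1.mul h2).mul h1.inv
  have h2 := h1.eventually (p := fun x => (chartAt E (1 : G)).symm (chartAt E (1 : G) x) = x)
    (by simpa using eventually_chart_left_inv)
  filter_upwards [h2] with p hp
  simp [coordMul, coordConj, hp]

theorem eventually_rightField_coordAdjoint :
    ∀ᶠ x in 𝓝 (baseCoord E G), ∀ w,
      rightField E G x (coordAdjoint E G x w) = leftField E G x w := by
  have h := eventually_coordMul_coordConj (E := E) (G := G)
  rw [nhds_prod_eq] at h
  filter_upwards [eventually_hasFDerivAt_coordAdjoint (E := E) (G := G), h.curry,
    eventually_hasFDerivAt_leftField (E := E) (G := G),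
    eventually_hasFDerivAt_rightField (E := E) (G := G)] with x h1 h2 h3 h4 w
  have h5 : HasFDerivAt (fun y => coordMul E G (coordConj E G (x, y), x))
      ((rightField E G x).comp (coordAdjoint E G x)) (baseCoord E G) := by
    refine HasFDerivAt.comp (f := fun y => coordConj E G (x, y))
      (g := fun z => coordMul E G (z, x)) (baseCoord E G) ?_ h1
    rwa [coordConj_base]
  exact congrArg (fun A : E →L[ℂ] E => A w) (h5.unique (h3.congr_of_eventuallyEq h2))

theorem coordAdjoint_base : coordAdjoint E G (baseCoord E G) = ContinuousLinearMap.id ℂ E := by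
  ext w
  have := (eventually_rightField_coordAdjoint (E := E) (G := G)).self_of_nhds w
  simpa [rightField_base, leftField_base] using this

/-- Product rule in `rightField x ∘ coordAdjoint x = leftField x`; the derivative of `rightField` is
that of `leftField` with arguments exchanged. -/
theorem fderiv_coordAdjoint_apply (v w : E) :
    fderiv ℂ (coordAdjoint E G) (baseCoord E G) v w =
      fderiv ℂ (leftField E G) (baseCoord E G) v w -
        fderiv ℂ (leftField E G) (baseCoord E G) w v := by
  have hA := ((contDiffAt_coordAdjoint (E := E) (G := G)).differentiableAt (by simp)).hasFDerivAt
  have hR := ((contDiffAt_rightField (E := E) (G := G)).differentiableAt (by simp)).hasFDerivAt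
  have hL := ((contDiffAt_leftField (E := E) (G := G)).differentiableAt (by simp)).hasFDerivAt
  have h1 := hR.clm_comp hA
  have h2 : (fun x => (rightField E G x).comp (coordAdjoint E G x)) =ᶠ[𝓝 (baseCoord E G)]
      leftField E G := by
    filter_upwards [eventually_rightField_coordAdjoint (E := E) (G := G)] with x hx
    ext w
    exact hx w
  have h3 := h1.unique (hL.congr_of_eventuallyEq h2)
  have h4 := congrArg (fun A : E →L[ℂ] E →L[ℂ] E => A v w) h3
  simp only [add_apply, ContinuousLinearMap.comp_apply,
    ContinuousLinearMap.compL_apply, ContinuousLinearMap.flip_apply, rightField_base,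
    coordAdjoint_base, ContinuousLinearMap.id_apply] at h4
  rw [fderiv_rightField_apply] at h4
  rw [← h4]
  abel

end Adjoint


/-! ### Velocities of curves through the identity -/

section Velocity

variable {E : Type*} [NormedAddCommGroup E] [NormedSpace ℂ E]
  {G : Type*} [TopologicalSpace G] [ChartedSpace E G] [Group G]

variable (E) in
/-- The curve `σ` in the Lie group `G` passes through `1` at time `0` with velocity `v`. -/
structure HasVelocity (σ : ℝ → G) (v : E) : Prop where
  base : σ 0 = 1
  continuousAt : ContinuousAt σ 0
  hasDerivAt : HasDerivAt (fun t => chartAt E (1 : G) (σ t)) v 0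

namespace HasVelocity

variable {σ τ : ℝ → G} {v w : E}

theorem eventually_symm_chart (h : HasVelocity E σ v) :
    ∀ᶠ t in 𝓝 0, (chartAt E (1 : G)).symm (chartAt E (1 : G) (σ t)) = σ t := by
  refine h.continuousAt.eventually (p := fun x =>
    (chartAt E (1 : G)).symm (chartAt E (1 : G) x) = x) ?_
  rw [h.base]
  exact eventually_chart_left_inv

theorem chart_zero (h : HasVelocity E σ v) : chartAt E (1 : G) (σ 0) = baseCoord E G := by
  rw [h.base, baseCoord_def]

theorem tendsto_chart (h : HasVelocity E σ v) :
    Filter.Tendsto (fun t => chartAt E (1 : G) (σ t)) (𝓝 0) (𝓝 (baseCoord E G)) := by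
  have := h.hasDerivAt.continuousAt.tendsto
  rwa [h.chart_zero] at this

theorem unique (h : HasVelocity E σ v) (h' : HasVelocity E σ w) : v = w :=
  h.hasDerivAt.unique h'.hasDerivAt

theorem map (h : HasVelocity E σ v) {f : G → G} {A : E →L[ℂ] E} (hf : f 1 = 1)
    (hfc : ContinuousAt f 1)
    (hA : HasFDerivAt (fun y => chartAt E (1 : G) (f ((chartAt E (1 : G)).symm y))) A
      (baseCoord E G)) : HasVelocity E (fun t => f (σ t)) (A v) := by
  refine ⟨by simp only [h.base, hf], ?_, ?_⟩
  · refine ContinuousAt.comp (g := f) ?_ h.continuousAt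
    rwa [h.base]
  · rw [← h.chart_zero] at hA
    refine ((hA.restrictScalars ℝ).comp_hasDerivAt 0 h.hasDerivAt).congr_of_eventuallyEq ?_
    filter_upwards [h.eventually_symm_chart] with t ht
    simp only [Function.comp_apply, ht]

theorem exists_curve (v : E) : ∃ σ : ℝ → G, HasVelocity E σ v := by
  have h1 : HasDerivAt (fun t : ℝ => baseCoord E G + t • v) v 0 := by
    simpa using ((hasDerivAt_id (0 : ℝ)).smul_const v).const_add (baseCoord E G)
  have h2 : Filter.Tendsto (fun t : ℝ => baseCoord E G + t • v) (𝓝 0) (𝓝 (baseCoord E G)) := by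
    simpa using h1.continuousAt.tendsto
  refine ⟨fun t => (chartAt E (1 : G)).symm (baseCoord E G + t • v), by simp, ?_, ?_⟩
  · refine ContinuousAt.comp (g := (chartAt E (1 : G)).symm) ?_ h1.continuousAt
    simpa using continuousAt_chart_symm_base
  · exact h1.congr_of_eventuallyEq (h2.eventually eventually_chart_right_inv)

theorem const_one : HasVelocity E (fun _ => (1 : G)) 0 :=
  ⟨rfl, continuousAt_const, hasDerivAt_const _ _⟩

variable [LieGroup 𝓘(ℂ, E) ω G]

theorem mul (h : HasVelocity E σ v) (h' : HasVelocity E τ w) :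
    HasVelocity E (fun t => σ t * τ t) (v + w) := by
  have : ContinuousMul G := continuousMul_of_contMDiffMul 𝓘(ℂ, E) ω
  refine ⟨by simp [h.base, h'.base], h.continuousAt.mul h'.continuousAt, ?_⟩
  have h1 := (hasFDerivAt_coordMul (E := E) (G := G)).restrictScalars ℝ
  have h2 := h.hasDerivAt.prodMk h'.hasDerivAt
  have h3 : ((chartAt E (1 : G) (σ 0), chartAt E (1 : G) (τ 0)) : E × E) =
      (baseCoord E G, baseCoord E G) := by rw [h.chart_zero, h'.chart_zero]
  rw [← h3] at h1
  have h4 := h1.comp_hasDerivAt (0 : ℝ) h2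
  have h5 : ((ContinuousLinearMap.fst ℂ E E + ContinuousLinearMap.snd ℂ E E).restrictScalars ℝ)
      (v, w) = v + w := rfl
  rw [h5] at h4
  refine h4.congr_of_eventuallyEq ?_
  filter_upwards [h.eventually_symm_chart, h'.eventually_symm_chart] with t ht ht'
  simp only [Function.comp_apply, coordMul, ht, ht']

theorem conj (h : HasVelocity E σ v) (g : G) :
    HasVelocity E (fun t => g * σ t * g⁻¹) (adjoint E g v) := by
  have : ContinuousMul G := continuousMul_of_contMDiffMul 𝓘(ℂ, E) ω
  exact h.map (f := fun x => g * x * g⁻¹) (by simp) (by fun_prop) (hasFDerivAt_adjoint g)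

/-- The product of `σ` and its inverse is constant, so the two velocities add up to zero. -/
theorem inv (h : HasVelocity E σ v) : HasVelocity E (fun t => (σ t)⁻¹) (-v) := by
  have : IsTopologicalGroup G := topologicalGroup_of_lieGroup 𝓘(ℂ, E) ω
  have hd : DifferentiableAt ℂ
      (fun y => chartAt E (1 : G) ((chartAt E (1 : G)).symm y)⁻¹) (baseCoord E G) := by
    refine ContDiffAt.differentiableAt (n := ω) ?_ (by simp)
    rw [← contMDiffAt_iff_contDiffAt]
    exact ContMDiffAt.comp (baseCoord E G) (g := chartAt E (1 : G))
      (contMDiffAt_chart_of_mem (by simp)) (contMDiffAt_chart_symm_of_mem baseCoord_mem).inv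
  have h1 := h.map (f := fun x => x⁻¹) inv_one (by fun_prop) hd.hasFDerivAt
  have h2 := h.mul h1
  simp only [mul_inv_cancel] at h2
  have h3 := h2.unique const_one
  rwa [eq_neg_of_add_eq_zero_right h3] at h1

/-- The derivative is the bracket of `v` and `w`, by `bracket_eq_sub`. Brackets thus stay in any
closed subspace that contains the curve. -/
theorem hasDerivAt_adjoint (h : HasVelocity E σ v) (w : E) :
    HasDerivAt (fun t => adjoint E (σ t) w)
      (fderiv ℂ (leftField E G) (baseCoord E G) v w -
        fderiv ℂ (leftField E G) (baseCoord E G) w v) 0 := by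
  have hA := (((contDiffAt_coordAdjoint (E := E) (G := G)).differentiableAt
    (by simp)).hasFDerivAt).clm_apply (hasFDerivAt_const w (baseCoord E G))
  rw [← h.chart_zero] at hA
  have h1 := (hA.restrictScalars ℝ).comp_hasDerivAt (0 : ℝ) h.hasDerivAt
  rw [← fderiv_coordAdjoint_apply]
  convert h1.congr_of_eventuallyEq ?_ using 1
  · rw [h.chart_zero]
    simp
  · filter_upwards [h.eventually_symm_chart, h.tendsto_chart.eventually eventually_adjoint_eq]
      with t ht ht'
    rw [ht] at ht'
    rw [ht']
    rfl

end HasVelocity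

end Velocity

theorem HasDerivAt.mem_of_forall_mem {E : Type*} [NormedAddCommGroup E] [NormedSpace ℝ E]
    {S : Submodule ℝ E} (hS : IsClosed (S : Set E)) {f : ℝ → E} {f' : E} {t : ℝ}
    (hf : HasDerivAt f f' t) (h : ∀ s, f s ∈ S) : f' ∈ S := by
  refine hS.mem_of_tendsto (hasDerivAt_iff_tendsto_slope.1 hf) (Filter.Eventually.of_forall ?_)
  intro s
  exact S.smul_mem _ (S.sub_mem (h s) (h t))

/-! ### From the upper central series to a central filtration of the Lie algebra -/

section Nilpotent

variable {E : Type*} [NormedAddCommGroup E] [NormedSpace ℂ E]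
  {G : Type*} [TopologicalSpace G] [ChartedSpace E G] [Group G]

variable (E G) in
/-- The ascending filtration of the Lie algebra on whose successive quotients the adjoint action
is trivial. -/
noncomputable def adjointFiltration : ℕ → Submodule ℂ E
  | 0 => ⊥
  | j + 1 => ⨅ g : G, (adjointFiltration j).comap
      ((adjoint E g : E →ₗ[ℂ] E) - LinearMap.id)

theorem mem_adjointFiltration_succ {j : ℕ} {v : E} :
    v ∈ adjointFiltration E G (j + 1) ↔ ∀ g : G, adjoint E g v - v ∈ adjointFiltration E G j := by
  simp [adjointFiltration, Submodule.mem_iInf]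

variable [LieGroup 𝓘(ℂ, E) ω G]

/-- The commutator curve `g * σ t * g⁻¹ * (σ t)⁻¹` has velocity `Ad(g) v - v` and lies one step
lower in the upper central series. No Lie subgroup structure on that series is needed. -/
theorem HasVelocity.mem_adjointFiltration (j : ℕ) {σ : ℝ → G} {v : E} (h : HasVelocity E σ v)
    (hσ : ∀ t, σ t ∈ Subgroup.upperCentralSeries G j) : v ∈ adjointFiltration E G j := by
  induction j generalizing σ v with
  | zero =>
    have : σ = fun _ => 1 := funext fun t => by simpa using hσ t
    subst this
    exact (Submodule.mem_bot ℂ).2 (h.unique HasVelocity.const_one)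
  | succ j ih =>
    rw [mem_adjointFiltration_succ]
    intro g
    rw [sub_eq_add_neg]
    refine ih ((h.conj g).mul h.inv) fun t => ?_
    -- This is the commutator of `σ t` with `g`; the one wanted is its inverse.
    have h1 := Subgroup.mem_upperCentralSeries_succ_iff.1 (hσ t) g
    have h2 := (Subgroup.upperCentralSeries G j).inv_mem h1
    rwa [commutatorElement_inv, commutatorElement_def] at h2

theorem exists_adjointFiltration_eq_top (hG : Group.IsNilpotent G) :
    ∃ n, adjointFiltration E G n = ⊤ := by
  obtain ⟨n, hn⟩ := hG.nilpotent
  refine ⟨n, eq_top_iff.2 fun v _ => ?_⟩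
  obtain ⟨σ, hσ⟩ := HasVelocity.exists_curve (G := G) v
  exact hσ.mem_adjointFiltration n fun t => hn ▸ Subgroup.mem_top _

theorem lie_mem_adjointFiltration [FiniteDimensional ℂ E] {j : ℕ}
    {x v : GroupLieAlgebra 𝓘(ℂ, E) G} (hv : (v : E) ∈ adjointFiltration E G (j + 1)) :
    (⁅x, v⁆ : GroupLieAlgebra 𝓘(ℂ, E) G) ∈ adjointFiltration E G j := by
  obtain ⟨σ, hσ⟩ := HasVelocity.exists_curve (E := E) (G := G) x
  rw [bracket_eq_sub]
  exact HasDerivAt.mem_of_forall_mem (E := E) (S := (adjointFiltration E G j).restrictScalars ℝ)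
    (Submodule.closed_of_finiteDimensional _)
    (HasDerivAt.sub_const (F := E) v (hσ.hasDerivAt_adjoint (E := E) v))
    fun t => (mem_adjointFiltration_succ (E := E)).1 hv (σ t)

end Nilpotent


/-! ### The Lie algebra of a subgroup -/

section SubLie

variable {E : Type*} [NormedAddCommGroup E] [NormedSpace ℂ E]
  {G : Type*} [TopologicalSpace G] [ChartedSpace E G]

/-- Curves are smooth over `ℝ` and multiplication is analytic over `ℂ`; in charts the scalars of the
latter can be restricted. -/
theorem contMDiffAt_curve_iff {γ : ℝ → G} {t : ℝ} :
    ContMDiffAt 𝓘(ℝ, ℝ) 𝓘(ℝ, E) ∞ γ t ↔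
      ContinuousAt γ t ∧ ContDiffAt ℝ ∞ (fun s => chartAt E (γ t) (γ s)) t := by
  rw [contMDiffAt_iff_target, contMDiffAt_iff_contDiffAt]
  simp only [mfld_simps]
  rfl

variable [Group G] [LieGroup 𝓘(ℂ, E) ω G]

/-- The product of two real smooth curves in a complex Lie group is smooth. -/
theorem contMDiff_curve_mul {γ δ : ℝ → G} (hγ : ContMDiff 𝓘(ℝ, ℝ) 𝓘(ℝ, E) ∞ γ)
    (hδ : ContMDiff 𝓘(ℝ, ℝ) 𝓘(ℝ, E) ∞ δ) :
    ContMDiff 𝓘(ℝ, ℝ) 𝓘(ℝ, E) ∞ (fun t => γ t * δ t) := by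
  have : ContinuousMul G := continuousMul_of_contMDiffMul 𝓘(ℂ, E) ω
  intro t
  obtain ⟨c1, d1⟩ := contMDiffAt_curve_iff.1 (hγ t)
  obtain ⟨c2, d2⟩ := contMDiffAt_curve_iff.1 (hδ t)
  rw [contMDiffAt_curve_iff]
  refine ⟨c1.mul c2, ?_⟩
  have h1 : ContDiffAt ℝ ∞ (fun p : E × E => chartAt E (γ t * δ t)
      ((chartAt E (γ t)).symm p.1 * (chartAt E (δ t)).symm p.2))
      (chartAt E (γ t) (γ t), chartAt E (δ t) (δ t)) :=
    ((contDiffAt_chart_mul (E := E) (γ t) (δ t) (γ t * δ t)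
      (p := (chartAt E (γ t) (γ t), chartAt E (δ t) (δ t)))
      (mem_chart_target E _) (mem_chart_target E _) (by simp)).of_le (by simp)).restrict_scalars ℝ
  refine (ContDiffAt.comp (f := fun s => (chartAt E (γ t) (γ s), chartAt E (δ t) (δ s))) t h1
    (d1.prodMk d2)).congr_of_eventuallyEq ?_
  have e1 := c1.eventually_mem ((chartAt E (γ t)).open_source.mem_nhds (mem_chart_source E _))
  have e2 := c2.eventually_mem ((chartAt E (δ t)).open_source.mem_nhds (mem_chart_source E _))
  filter_upwards [e1, e2] with s h1 h2
  simp only [Function.comp_apply, (chartAt E (γ t)).left_inv h1, (chartAt E (δ t)).left_inv h2]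

variable (E) in
/-- The Lie algebra of a subgroup is a real subspace. -/
def subLieSubmodule (G₀ : Subgroup G) : Submodule ℝ E where
  carrier := {v | ∃ γ : ℝ → G, ContMDiff 𝓘(ℝ, ℝ) 𝓘(ℝ, E) ∞ γ ∧ (∀ t, γ t ∈ G₀) ∧
    HasVelocity E γ v}
  add_mem' := by
    intro v w hv hw
    obtain ⟨γ, h1, h2, h3⟩ := hv
    obtain ⟨δ, k1, k2, k3⟩ := hw
    exact ⟨_, contMDiff_curve_mul h1 k1, fun t => G₀.mul_mem (h2 t) (k2 t), h3.mul k3⟩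
  zero_mem' := ⟨_, contMDiff_const, fun _ => G₀.one_mem, HasVelocity.const_one⟩
  smul_mem' := by
    intro c v hv
    obtain ⟨γ, h1, h2, h3⟩ := hv
    have hc : ContDiff ℝ ∞ (fun t : ℝ => c * t) := by fun_prop
    refine ⟨fun t => γ (c * t), h1.comp hc.contMDiff, fun t => h2 _, by simp [h3.base], ?_, ?_⟩
    · exact (h1.continuous.comp hc.continuous).continuousAt
    · have h4 : HasDerivAt (fun t : ℝ => c * t) c 0 := by
        simpa using (hasDerivAt_id (0 : ℝ)).const_mul c
      have h5 := h3.hasDerivAt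
      rw [← mul_zero c] at h5
      exact h5.scomp 0 h4

theorem mem_subLieSubmodule {G₀ : Subgroup G} {v : E} :
    v ∈ subLieSubmodule E G₀ ↔
      ∃ γ : ℝ → G, ContMDiff 𝓘(ℝ, ℝ) 𝓘(ℝ, E) ∞ γ ∧ (∀ t, γ t ∈ G₀) ∧ HasVelocity E γ v :=
  Iff.rfl

theorem coe_subLieSubmodule (G₀ : Subgroup G) :
    (subLieSubmodule E G₀ : Set E) = subLie E G₀ := by
  ext v
  constructor
  · rintro ⟨γ, h1, h2, h3⟩
    exact ⟨γ, h1, h2, h3.base, h3.hasDerivAt⟩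
  · rintro ⟨γ, h1, h2, h3, h4⟩
    exact ⟨γ, h1, h2, h3, h1.continuous.continuousAt, h4⟩

theorem adjoint_mem_subLieSubmodule {G₀ : Subgroup G} {v : E} (hv : v ∈ subLieSubmodule E G₀)
    {g : G} (hg : g ∈ G₀) : adjoint E g v ∈ subLieSubmodule E G₀ := by
  rw [mem_subLieSubmodule] at *
  obtain ⟨γ, h1, h2, h3⟩ := hv
  exact ⟨_, contMDiff_curve_mul (contMDiff_curve_mul contMDiff_const h1) contMDiff_const,
    fun t => G₀.mul_mem (G₀.mul_mem hg (h2 t)) (G₀.inv_mem hg), h3.conj g⟩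

/-- The bracket is the derivative of `Ad(γ t) v` for a curve `γ` in `G₀`; this curve stays in the
subspace, which is closed by finite dimension. -/
theorem lie_mem_subLieSubmodule [FiniteDimensional ℂ E] {G₀ : Subgroup G}
    {x v : GroupLieAlgebra 𝓘(ℂ, E) G} (hx : (x : E) ∈ subLieSubmodule E G₀)
    (hv : (v : E) ∈ subLieSubmodule E G₀) :
    (⁅x, v⁆ : GroupLieAlgebra 𝓘(ℂ, E) G) ∈ subLieSubmodule E G₀ := by
  have : FiniteDimensional ℝ E := FiniteDimensional.complexToReal E
  obtain ⟨γ, -, h2, h3⟩ := (mem_subLieSubmodule (E := E)).1 hx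
  rw [bracket_eq_sub]
  exact HasDerivAt.mem_of_forall_mem (E := E) (Submodule.closed_of_finiteDimensional _)
    (h3.hasDerivAt_adjoint (E := E) v) fun t => adjoint_mem_subLieSubmodule (E := E) hv (h2 t)

end SubLie


/-! ### A closed form on a quotient manifold, along the generators of the left action -/

section LocalForm

variable {E : Type*} [NormedAddCommGroup E]
  {G : Type*} [TopologicalSpace G] [ChartedSpace E G] [Group G]
  {Q : Type*}

/-- The orbit map through `π g`, in the preferred chart of `G` at the identity. -/
def orbitMap (π : G → Q) (g : G) (y : E) : Q := π ((chartAt E (1 : G)).symm y * g)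

theorem orbitMap_base {π : G → Q} (g : G) : orbitMap π g (baseCoord E G) = π g := by
  simp [orbitMap]

variable [TopologicalSpace Q] [ChartedSpace E Q]

/-- The orbit map through `π g`, read in charts. -/
noncomputable def coordOrbit (π : G → Q) (g : G) (y : E) : E :=
  chartAt E (π g) (orbitMap π g y)

theorem coordOrbit_base {π : G → Q} (g : G) : coordOrbit (E := E) π g (baseCoord E G) =
    chartAt E (π g) (π g) := by
  rw [coordOrbit, orbitMap_base]

variable [NormedSpace ℂ E]

/-- The derivative of the orbit map through `π g`. -/
noncomputable def orbitDeriv (π : G → Q) (g : G) (y : E) : E →L[ℂ] E :=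
  mfderiv 𝓘(ℂ, E) 𝓘(ℂ, E) (orbitMap π g) y

/-- The value of the form `η` at `π g` on the generators of the left action of `G` given by
`V` and `W`. -/
noncomputable def pairing (η : ∀ x : Q, TangentSpace 𝓘(ℂ, E) x [⋀^Fin 2]→L[ℝ] ℝ) (π : G → Q)
    (V W : E) (g : G) : ℝ :=
  η (π g) ![orbitDeriv π g (baseCoord E G) V, orbitDeriv π g (baseCoord E G) W]

/-- The pullback of `η` under the orbit map through `π g`. -/
noncomputable def localForm (η : ∀ x : Q, TangentSpace 𝓘(ℂ, E) x [⋀^Fin 2]→L[ℝ] ℝ) (π : G → Q)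
    (g : G) (y : E) : E [⋀^Fin 2]→L[ℝ] ℝ :=
  (coordForm η (chartAt E (π g)) (coordOrbit π g y)).compContinuousLinearMap
    (fderiv ℝ (coordOrbit π g) y)

theorem form_congr_base {η : ∀ x : Q, TangentSpace 𝓘(ℂ, E) x [⋀^Fin 2]→L[ℝ] ℝ} {x x' : Q}
    (h : x = x') (a b : E) : η x ![a, b] = η x' ![a, b] := by
  subst h
  rfl

variable {η : ∀ x : Q, TangentSpace 𝓘(ℂ, E) x [⋀^Fin 2]→L[ℝ] ℝ} {π : G → Q}

theorem pairing_mul_right {γ : G} (hγ : ∀ x, π (x * γ) = π x) (V W : E) (g : G) :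
    pairing η π V W (g * γ) = pairing η π V W g := by
  have h : (orbitMap π (g * γ) : E → Q) = orbitMap π g := by
    ext y
    simp [orbitMap, ← mul_assoc, hγ]
  rw [pairing, pairing, orbitDeriv, orbitDeriv, h]
  exact form_congr_base (hγ g) _ _

variable [LieGroup 𝓘(ℂ, E) ω G]

theorem contMDiffAt_orbitMap (hπ : ContMDiff 𝓘(ℂ, E) 𝓘(ℂ, E) ω π) (g : G) {y : E}
    (hy : y ∈ (chartAt E (1 : G)).target) :
    ContMDiffAt 𝓘(ℂ, E) 𝓘(ℂ, E) ω (orbitMap π g) y :=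
  hπ.contMDiffAt.comp y ((contMDiffAt_chart_symm_of_mem hy).mul contMDiffAt_const)

theorem eventually_orbitMap_mem (hπ : ContMDiff 𝓘(ℂ, E) 𝓘(ℂ, E) ω π) (g : G) :
    ∀ᶠ y in 𝓝 (baseCoord E G), (orbitMap π g y : Q) ∈ (chartAt E (π g)).source := by
  refine (contMDiffAt_orbitMap hπ g baseCoord_mem).continuousAt.eventually_mem
    ((chartAt E (π g)).open_source.mem_nhds ?_)
  rw [orbitMap_base]
  exact mem_chart_source E _

variable [IsManifold 𝓘(ℂ, E) ω Q]

theorem contDiffAt_coordOrbit (hπ : ContMDiff 𝓘(ℂ, E) 𝓘(ℂ, E) ω π) (g : G) :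
    ContDiffAt ℂ ω (coordOrbit (E := E) π g) (baseCoord E G) := by
  rw [← contMDiffAt_iff_contDiffAt]
  refine ContMDiffAt.comp (baseCoord E G) (g := chartAt E (π g)) ?_
    (contMDiffAt_orbitMap hπ g baseCoord_mem)
  rw [orbitMap_base]
  exact (contMDiffOn_chart (I := 𝓘(ℂ, E)) (n := ω) (x := π g)).contMDiffAt
    ((chartAt E (π g)).open_source.mem_nhds (mem_chart_source E _))

theorem eventually_orbitDeriv_eq (hπ : ContMDiff 𝓘(ℂ, E) 𝓘(ℂ, E) ω π) (g : G) :
    ∀ᶠ y in 𝓝 (baseCoord E G), orbitDeriv π g y =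
      (mfderiv 𝓘(ℂ, E) 𝓘(ℂ, E) (chartAt E (π g)).symm (coordOrbit π g y) : E →L[ℂ] E).comp
        (fderiv ℂ (coordOrbit (E := E) π g) y) := by
  have hI : IsManifold 𝓘(ℂ, E) 1 Q := IsManifold.of_le (n := ω) (by simp)
  filter_upwards [(eventually_orbitMap_mem hπ g).eventually_nhds,
    (contDiffAt_coordOrbit hπ g).eventually (by simp)] with y h1 h2
  have h3 : orbitMap π g =ᶠ[𝓝 y] fun z => (chartAt E (π g)).symm (coordOrbit π g z) := by
    filter_upwards [h1] with z hz
    exact ((chartAt E (π g)).left_inv hz).symm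
  have h4 : coordOrbit π g y ∈ (chartAt E (π g)).target :=
    (chartAt E (π g)).map_source h1.self_of_nhds
  have h5 := (mdifferentiableAt_atlas_symm (I := 𝓘(ℂ, E)) (chart_mem_atlas E (π g)) h4).hasMFDerivAt
  have h6 := ((h2.differentiableAt (by simp)).hasFDerivAt).hasMFDerivAt
  exact ((HasMFDerivAt.comp y h5 h6).congr_of_eventuallyEq h3).mfderiv

/-- Near `g` the orbit map through the moved point is the one through `π g` after a right
translation. So the generators of the left action are the right invariant fields. -/
theorem eventually_pairing_eq (hπ : ContMDiff 𝓘(ℂ, E) 𝓘(ℂ, E) ω π) (g : G) (V W : E) :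
    ∀ᶠ y in 𝓝 (baseCoord E G), pairing η π V W ((chartAt E (1 : G)).symm y * g) =
      localForm η π g y ![rightField E G y V, rightField E G y W] := by
  have : ContinuousMul G := continuousMul_of_contMDiffMul 𝓘(ℂ, E) ω
  have h := (eventually_symm_coordMul (E := E) (G := G))
  rw [nhds_prod_eq] at h
  filter_upwards [(Filter.eventually_swap_iff.1 h).curry,
    eventually_hasFDerivAt_rightField (E := E) (G := G), coordMul_base_left (E := E) (G := G),
    eventually_orbitDeriv_eq hπ g, eventually_orbitMap_mem hπ g,
    (contDiffAt_coordOrbit hπ g).eventually (by simp),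
    (chartAt E (1 : G)).open_target.mem_nhds baseCoord_mem] with y h1 h2 h3 h4 h5 h6 h7
  have h8 : orbitDeriv π ((chartAt E (1 : G)).symm y * g) (baseCoord E G) =
      (orbitDeriv π g y).comp (rightField E G y) := by
    have e1 : orbitMap (E := E) π ((chartAt E (1 : G)).symm y * g) =ᶠ[𝓝 (baseCoord E G)]
        fun z : E => orbitMap π g (coordMul E G (z, y)) := by
      filter_upwards [h1] with z hz
      simp only [Prod.swap_prod_mk] at hz
      rw [orbitMap, orbitMap, hz, mul_assoc]
    have e2 : HasMFDerivAt 𝓘(ℂ, E) 𝓘(ℂ, E) (fun z => orbitMap π g (coordMul E G (z, y)))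
        (baseCoord E G) ((orbitDeriv π g y).comp (rightField E G y)) := by
      refine HasMFDerivAt.comp (I' := 𝓘(ℂ, E)) (g := orbitMap π g)
        (f := fun z => coordMul E G (z, y)) (baseCoord E G) ?_ h2.hasMFDerivAt
      rw [h3]
      exact ((contMDiffAt_orbitMap hπ g h7).mdifferentiableAt (by simp)).hasMFDerivAt
    exact (e2.congr_of_eventuallyEq e1).mfderiv
  have h9 : fderiv ℝ (coordOrbit (E := E) π g) y =
      (fderiv ℂ (coordOrbit (E := E) π g) y).restrictScalars ℝ :=
    (h6.differentiableAt (by simp)).fderiv_restrictScalars ℝ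
  have h10 : π ((chartAt E (1 : G)).symm y * g) =
      (chartAt E (π g)).symm (coordOrbit π g y) := ((chartAt E (π g)).left_inv h5).symm
  rw [pairing, h8, h4, form_congr_base h10, localForm, h9, coordForm]
  refine congrArg (a₂ := fun i => mfderiv 𝓘(ℂ, E) 𝓘(ℂ, E) (chartAt E (π g)).symm
    (coordOrbit π g y) (fderiv ℂ (coordOrbit (E := E) π g) y
      ((![rightField E G y V, rightField E G y W] : Fin 2 → E) i)))
    (η ((chartAt E (π g)).symm (coordOrbit π g y))) ?_
  funext i
  fin_cases i <;> rfl

end LocalForm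

/-- The general invariant formula with its sums expanded; the auxiliary equalities only identify
tuples with entries removed. -/
theorem extDeriv_two_form_apply {E : Type*} [NormedAddCommGroup E] [NormedSpace ℝ E]
    {α : E → E [⋀^Fin 2]→L[ℝ] ℝ} {A B C : E → E} {x : E} (hα : DifferentiableAt ℝ α x)
    (hA : DifferentiableAt ℝ A x) (hB : DifferentiableAt ℝ B x) (hC : DifferentiableAt ℝ C x) :
    extDeriv α x ![A x, B x, C x] =
      fderiv ℝ (fun y => α y ![B y, C y]) x (A x) - fderiv ℝ (fun y => α y ![A y, C y]) x (B x) +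
        fderiv ℝ (fun y => α y ![A y, B y]) x (C x) -
        α x ![VectorField.lieBracket ℝ A B x, C x] + α x ![VectorField.lieBracket ℝ A C x, B x] -
        α x ![VectorField.lieBracket ℝ B C x, A x] := by
  have h := extDeriv_apply_vectorField (V := ![A, B, C]) hα
    (fun i => by fin_cases i <;> assumption)
  have e : (fun i => (![A, B, C] : Fin 3 → E → E) i x) = ![A x, B x, C x] := by
    ext i; fin_cases i <;> rfl
  have e0 : ∀ y, (0 : Fin 3).removeNth (fun i => (![A, B, C] : Fin 3 → E → E) i y) =
    ![B y, C y] := fun y => by ext i; fin_cases i <;> rfl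
  have e1 : ∀ y, (1 : Fin 3).removeNth (fun i => (![A, B, C] : Fin 3 → E → E) i y) =
    ![A y, C y] := fun y => by ext i; fin_cases i <;> rfl
  have e2 : ∀ y, (2 : Fin 3).removeNth (fun i => (![A, B, C] : Fin 3 → E → E) i y) =
    ![A y, B y] := fun y => by ext i; fin_cases i <;> rfl
  have f0 : ∀ l a b c : E, Matrix.vecCons l ((0 : Fin 2).removeNth
    ((Fin.castSucc 0).removeNth (![a, b, c] : Fin 3 → E))) = ![l, c] := fun l a b c => by
    ext i; fin_cases i <;> rfl
  have f1 : ∀ l a b c : E, Matrix.vecCons l ((1 : Fin 2).removeNth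
    ((Fin.castSucc 0).removeNth (![a, b, c] : Fin 3 → E))) = ![l, b] := fun l a b c => by
    ext i; fin_cases i <;> rfl
  have f2 : ∀ l a b c : E, Matrix.vecCons l ((1 : Fin 2).removeNth
    ((Fin.castSucc 1).removeNth (![a, b, c] : Fin 3 → E))) = ![l, a] := fun l a b c => by
    ext i; fin_cases i <;> rfl
  have s0 : (Finset.Ici (0 : Fin 2)) = {0, 1} := by decide
  have s1 : (Finset.Ici (1 : Fin 2)) = {1} := by decide
  rw [e, Fin.sum_univ_three, Fin.sum_univ_two] at h
  simp only [e0, e1, e2] at h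
  rw [h, s0, s1, Finset.sum_pair (by decide), Finset.sum_singleton, f0, f1, f2]
  simp
  ring

/-! ### Closedness of the form, expressed on generators -/

section Closed

variable {E : Type*} [NormedAddCommGroup E] [NormedSpace ℂ E]
  {G : Type*} [TopologicalSpace G] [ChartedSpace E G] [Group G] [LieGroup 𝓘(ℂ, E) ω G]

theorem hasStrictFDerivAt_rightField_apply (v : E) :
    HasStrictFDerivAt (fun y => rightField E G y v)
      (((ContinuousLinearMap.apply ℂ E v).comp
        (fderiv ℂ (rightField E G) (baseCoord E G))).restrictScalars ℝ) (baseCoord E G) :=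
  (HasStrictFDerivAt.comp (baseCoord E G) (ContinuousLinearMap.apply ℂ E v).hasStrictFDerivAt
    ((contDiffAt_rightField (E := E) (G := G)).hasStrictFDerivAt (by simp))).restrictScalars ℝ

variable (E G) in
/-- The Lie bracket of the Lie algebra of `G`, read in the preferred chart at the identity. -/
noncomputable def coordBracket (v w : E) : E :=
  fderiv ℂ (leftField E G) (baseCoord E G) v w - fderiv ℂ (leftField E G) (baseCoord E G) w v

/-- The derivative of `rightField` is the transpose of that of `leftField`, whence the sign. -/
theorem lieBracket_rightField (v w : E) :
    VectorField.lieBracket ℝ (fun y => rightField E G y v) (fun y => rightField E G y w)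
      (baseCoord E G) = -coordBracket E G v w := by
  rw [VectorField.lieBracket, (hasStrictFDerivAt_rightField_apply v).hasFDerivAt.fderiv,
    (hasStrictFDerivAt_rightField_apply w).hasFDerivAt.fderiv, rightField_base]
  have h : ∀ a b : E, (((ContinuousLinearMap.apply ℂ E b).comp
      (fderiv ℂ (rightField E G) (baseCoord E G))).restrictScalars ℝ) a =
      fderiv ℂ (leftField E G) (baseCoord E G) b a := fun a b => fderiv_rightField_apply a b
  simp only [ContinuousLinearMap.id_apply, h, coordBracket]
  abel

variable {Q : Type*} [TopologicalSpace Q] [ChartedSpace E Q]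
  {η : ∀ x : Q, TangentSpace 𝓘(ℂ, E) x [⋀^Fin 2]→L[ℝ] ℝ} {π : G → Q} {U : Set Q}

theorem contDiffAt_coordForm (hη : IsKahlerFormOn η U) (hU : IsOpen U) {q : Q} (hq : q ∈ U) :
    ContDiffAt ℝ ∞ (coordForm η (chartAt E q)) (chartAt E q q) := by
  refine (hη.smooth _ (chart_mem_atlas E q)).contDiffAt
    (((chartAt E q).isOpen_inter_preimage_symm hU).mem_nhds ⟨mem_chart_target E q, ?_⟩)
  simpa using hq

variable [IsManifold 𝓘(ℂ, E) ω Q]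

theorem contDiffAt_real_coordOrbit (hπ : ContMDiff 𝓘(ℂ, E) 𝓘(ℂ, E) ω π) (g : G) :
    ContDiffAt ℝ ω (coordOrbit (E := E) π g) (baseCoord E G) :=
  (contDiffAt_coordOrbit hπ g).restrict_scalars ℝ

/-- Strictness is what later makes difference quotients uniform in the base point. -/
theorem hasStrictFDerivAt_localForm (hη : IsKahlerFormOn η U) (hU : IsOpen U)
    (hπ : ContMDiff 𝓘(ℂ, E) 𝓘(ℂ, E) ω π) {g : G} (hg : π g ∈ U) :
    ∃ L : E →L[ℝ] E [⋀^Fin 2]→L[ℝ] ℝ, HasStrictFDerivAt (localForm η π g) L (baseCoord E G) := by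
  have h1 := contDiffAt_coordForm hη hU hg
  rw [← coordOrbit_base] at h1
  have h2 := contDiffAt_real_coordOrbit (E := E) hπ g
  exact ⟨_, HasStrictFDerivAt.continuousAlternatingMapCompContinuousLinearMap
    ((h1.hasStrictFDerivAt (by simp)).comp (baseCoord E G) (h2.hasStrictFDerivAt (by simp)))
    ((h2.fderiv_right (m := ω) (by simp)).hasStrictFDerivAt (by simp))⟩

theorem extDeriv_localForm (hη : IsKahlerFormOn η U) (hU : IsOpen U)
    (hπ : ContMDiff 𝓘(ℂ, E) 𝓘(ℂ, E) ω π) {g : G} (hg : π g ∈ U) :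
    extDeriv (localForm η π g) (baseCoord E G) = 0 := by
  have h1 := contDiffAt_coordForm hη hU hg
  have h3 := hη.closed _ (chart_mem_atlas E (π g)) (chartAt E (π g) (π g))
    ⟨mem_chart_target E _, by simpa using hg⟩
  rw [← coordOrbit_base] at h1 h3
  have h2 := contDiffAt_real_coordOrbit (E := E) hπ g
  have h4 := extDeriv_pullback (h1.differentiableAt (by simp)) h2 (by simp)
  rw [h3] at h4
  refine h4.trans ?_
  ext
  simp

/-- The derivative of the function `pairing η π V W` along the generator given by `X`. -/
noncomputable def pairingDeriv (η : ∀ x : Q, TangentSpace 𝓘(ℂ, E) x [⋀^Fin 2]→L[ℝ] ℝ) (π : G → Q)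
    (X V W : E) (g : G) : ℝ :=
  fderiv ℝ (fun y => pairing η π V W ((chartAt E (1 : G)).symm y * g)) (baseCoord E G) X

theorem hasStrictFDerivAt_pairing (hη : IsKahlerFormOn η U) (hU : IsOpen U)
    (hπ : ContMDiff 𝓘(ℂ, E) 𝓘(ℂ, E) ω π) {g : G} (hg : π g ∈ U) (V W : E) :
    HasStrictFDerivAt (fun y => pairing η π V W ((chartAt E (1 : G)).symm y * g))
      (fderiv ℝ (fun y => pairing η π V W ((chartAt E (1 : G)).symm y * g)) (baseCoord E G))
      (baseCoord E G) := by
  obtain ⟨L, hL⟩ := hasStrictFDerivAt_localForm hη hU hπ hg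
  have h0 : (fun y => localForm η π g y ![rightField E G y V, rightField E G y W]) =
      fun y => localForm η π g y fun i => rightField E G y ((![V, W] : Fin 2 → E) i) := by
    funext y
    congr 1
    ext i
    fin_cases i <;> rfl
  have h1 := hL.continuousAlternatingMap_apply (g := fun i y => rightField E G y (![V, W] i))
    fun i => hasStrictFDerivAt_rightField_apply (![V, W] i)
  rw [← h0] at h1
  have h2 := h1.congr_of_eventuallyEq ((eventually_pairing_eq hπ g V W).mono fun _ h => h.symm)
  exact h2.hasFDerivAt.fderiv ▸ h2

theorem pairing_eq_localForm (hπ : ContMDiff 𝓘(ℂ, E) 𝓘(ℂ, E) ω π) (g : G) (V W : E) :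
    pairing η π V W g = localForm η π g (baseCoord E G) ![V, W] := by
  have := (eventually_pairing_eq (η := η) hπ g V W).self_of_nhds
  simpa [rightField_base] using this

/-- The invariant formula for the exterior derivative of the pulled back form, which vanishes,
evaluated on three right invariant fields. -/
theorem pairingDeriv_cyclic (hη : IsKahlerFormOn η U) (hU : IsOpen U)
    (hπ : ContMDiff 𝓘(ℂ, E) 𝓘(ℂ, E) ω π) {g : G} (hg : π g ∈ U) (X W Z : E) :
    pairingDeriv η π X W Z g - pairingDeriv η π W X Z g + pairingDeriv η π Z X W g +
      pairing η π (coordBracket E G X W) Z g - pairing η π (coordBracket E G X Z) W g +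
      pairing η π (coordBracket E G W Z) X g = 0 := by
  obtain ⟨L, hL⟩ := hasStrictFDerivAt_localForm hη hU hπ hg
  have hd : ∀ v : E, DifferentiableAt ℝ (fun y => rightField E G y v) (baseCoord E G) :=
    fun v => (hasStrictFDerivAt_rightField_apply v).hasFDerivAt.differentiableAt
  have h1 := extDeriv_two_form_apply hL.hasFDerivAt.differentiableAt (hd X) (hd W) (hd Z)
  have h2 : ∀ A V W : E, fderiv ℝ (fun y => localForm η π g y
      ![rightField E G y V, rightField E G y W]) (baseCoord E G) A = pairingDeriv η π A V W g :=
    fun A V W => by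
      rw [pairingDeriv, Filter.EventuallyEq.fderiv_eq (eventually_pairing_eq hπ g V W)]
  have h3 : ∀ v w : E, localForm η π g (baseCoord E G) ![-v, w] = - pairing η π v w g := by
    intro v w
    rw [pairing_eq_localForm hπ]
    have e1 : ![-v, w] = Function.update ![v, w] 0 (-v) := by
      ext i
      fin_cases i <;> rfl
    have e2 : ![v, w] = Function.update ![v, w] 0 v := by
      ext i
      fin_cases i <;> rfl
    exact e1 ▸ ((localForm η π g (baseCoord E G)).toAlternatingMap.map_update_neg ![v, w] 0 v).trans
      (by rw [← e2]; rfl)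
  simp only [extDeriv_localForm hη hU hπ hg, h2, lieBracket_rightField, h3, rightField_base,
    ContinuousLinearMap.id_apply] at h1
  have h4 : (0 : E [⋀^Fin 3]→L[ℝ] ℝ) ![X, W, Z] = 0 := rfl
  rw [h4] at h1
  linarith

end Closed


/-! ### Uniform estimates from cocompactness -/

section Compact

variable {G : Type*} [TopologicalSpace G] [Group G] [IsTopologicalGroup G]

/-- A right `Γ`-invariant property which holds locally uniformly on `G₀` holds uniformly on `G₀`,
if `Γ` is cocompact in `G₀`. -/
theorem eventually_forall_mem_of_cocompact {Γ G₀ : Subgroup G}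
    [CompactSpace (G₀ ⧸ Γ.subgroupOf G₀)] {ι : Type*} {l : Filter ι} {p : G → ι → Prop}
    (hinv : ∀ γ ∈ Γ, ∀ g i, p g i → p (g * γ) i)
    (h : ∀ g ∈ G₀, ∀ᶠ q : G × ι in 𝓝 g ×ˢ l, p q.1 q.2) :
    ∀ᶠ i in l, ∀ g ∈ G₀, p g i := by
  have key : ∀ᶠ i in l, ∀ q ∈ (Set.univ : Set (G₀ ⧸ Γ.subgroupOf G₀)),
      ∀ g : G₀, (g : G₀ ⧸ Γ.subgroupOf G₀) = q → p g i := by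
    -- Tube lemma: by compactness, local statements around each point of the quotient combine into
    -- one along `l`.
    suffices H : ∀ q ∈ (Set.univ : Set (G₀ ⧸ Γ.subgroupOf G₀)), ∀ᶠ z in l ×ˢ 𝓝 q,
        ∀ g : G₀, (g : G₀ ⧸ Γ.subgroupOf G₀) = z.2 → p g z.1 by
      simp only [← Filter.eventually_iSup, ← isCompact_univ.prod_nhdsSet_eq_biSup] at H
      exact H.curry.mono fun _ h => h.self_of_nhdsSet
    intro q _
    induction q using QuotientGroup.induction_on with
    | H g =>
    obtain ⟨N, hN, T, hT, hNT⟩ := Filter.mem_prod_iff.1 (h g g.2)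
    -- The quotient map is open, and `hinv` carries the property from a representative in `N` to
    -- every other one.
    have h1 : (QuotientGroup.mk '' (Subtype.val ⁻¹' N) : Set (G₀ ⧸ Γ.subgroupOf G₀)) ∈
        𝓝 (g : G₀ ⧸ Γ.subgroupOf G₀) :=
      QuotientGroup.isOpenMap_coe.image_mem_nhds (continuous_subtype_val.continuousAt hN)
    filter_upwards [Filter.prod_mem_prod hT h1]
    rintro ⟨i, _⟩ ⟨hi, ⟨n, hn, rfl⟩⟩ g' hg'
    have h2 : n⁻¹ * g' ∈ Γ.subgroupOf G₀ := QuotientGroup.eq.1 hg'.symm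
    have h3 := hinv _ (Subgroup.mem_subgroupOf.1 h2) n i (hNT (Set.mk_mem_prod hn hi))
    simpa using h3
  filter_upwards [key] with i hi g hg
  exact hi _ trivial ⟨g, hg⟩ rfl

theorem exists_abs_le_of_cocompact {Γ G₀ : Subgroup G} [CompactSpace (G₀ ⧸ Γ.subgroupOf G₀)]
    {f : G → ℝ} (hinv : ∀ γ ∈ Γ, ∀ g, f (g * γ) = f g) (hf : ∀ g ∈ G₀, ContinuousAt f g) :
    ∃ C, ∀ g ∈ G₀, |f g| ≤ C := by
  refine (eventually_forall_mem_of_cocompact (Γ := Γ) (l := Filter.atTop)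
    (p := fun g C => |f g| ≤ C) (fun γ hγ g C h => by rwa [hinv γ hγ]) fun g hg => ?_).exists
  have h1 : ∀ᶠ g' in 𝓝 g, |f g'| < |f g| + 1 :=
    (hf g hg).abs.eventually_lt continuousAt_const (lt_add_one _)
  filter_upwards [Filter.prod_mem_prod h1 (Filter.eventually_ge_atTop (|f g| + 1))] with q hq
  exact hq.1.le.trans hq.2

theorem exists_pos_le_of_cocompact {Γ G₀ : Subgroup G} [CompactSpace (G₀ ⧸ Γ.subgroupOf G₀)]
    {f : G → ℝ} (hinv : ∀ γ ∈ Γ, ∀ g, f (g * γ) = f g) (hf : ∀ g ∈ G₀, ContinuousAt f g)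
    (hpos : ∀ g ∈ G₀, 0 < f g) : ∃ c, 0 < c ∧ ∀ g ∈ G₀, c ≤ f g := by
  have h := eventually_forall_mem_of_cocompact (Γ := Γ) (G₀ := G₀) (l := 𝓝[>] (0 : ℝ))
    (p := fun g c => c ≤ f g) (fun γ hγ g C h => by rwa [hinv γ hγ]) fun g hg => by
      have h1 : ∀ᶠ g' in 𝓝 g, f g / 2 < f g' :=
        continuousAt_const.eventually_lt (hf g hg) (half_lt_self (hpos g hg))
      have h2 : ∀ᶠ c in 𝓝[>] (0 : ℝ), c < f g / 2 :=
        (eventually_lt_nhds (half_pos (hpos g hg))).filter_mono nhdsWithin_le_nhds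
      filter_upwards [Filter.prod_mem_prod h1 h2] with q hq
      exact hq.2.le.trans hq.1.le
  obtain ⟨c, hc, hc0⟩ := (h.and self_mem_nhdsWithin).exists
  exact ⟨c, hc0, hc⟩

end Compact

section Elementary

variable {E : Type*} [NormedAddCommGroup E] [NormedSpace ℂ E]
  {G : Type*} [TopologicalSpace G] [ChartedSpace E G] [Group G]

theorem coordBracket_swap (v w : E) : coordBracket E G w v = -coordBracket E G v w := by
  simp [coordBracket]

variable {Q : Type*} [TopologicalSpace Q] [ChartedSpace E Q]
  {η : ∀ x : Q, TangentSpace 𝓘(ℂ, E) x [⋀^Fin 2]→L[ℝ] ℝ} {π : G → Q}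

theorem pairingDeriv_mul_right {γ : G} (hγ : ∀ x, π (x * γ) = π x) (X V W : E) (g : G) :
    pairingDeriv η π X V W (g * γ) = pairingDeriv η π X V W g := by
  simp only [pairingDeriv, ← mul_assoc, pairing_mul_right hγ]

end Elementary

/-! ### Derivatives along curves, uniformly in the base point -/

section Derivative

variable {E : Type*} [NormedAddCommGroup E]
  {G : Type*} [TopologicalSpace G] [ChartedSpace E G] [Group G] [IsTopologicalGroup G]

theorem tendsto_chart_mul_inv (g : G) :
    Filter.Tendsto (fun g' => chartAt E (1 : G) (g' * g⁻¹)) (𝓝 g) (𝓝 (baseCoord E G)) := by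
  have h1 : ContinuousAt (fun g' => g' * g⁻¹) g := by fun_prop
  have h2 : ContinuousAt (chartAt E (1 : G)) (g * g⁻¹) := by
    rw [mul_inv_cancel]
    exact (chartAt E (1 : G)).continuousAt (mem_chart_source E 1)
  have h3 := ContinuousAt.comp (f := fun g' => g' * g⁻¹) h2 h1
  simpa [ContinuousAt, baseCoord_def, Function.comp_def] using h3

theorem eventually_chart_symm_mul (g : G) :
    ∀ᶠ g' in 𝓝 g, (chartAt E (1 : G)).symm (chartAt E (1 : G) (g' * g⁻¹)) * g = g' := by
  have h1 : Filter.Tendsto (fun g' => g' * g⁻¹) (𝓝 g) (𝓝 1) := by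
    have : ContinuousAt (fun g' => g' * g⁻¹) g := by fun_prop
    simpa [ContinuousAt] using this
  filter_upwards [h1.eventually (eventually_chart_left_inv (E := E))] with g' hg'
  rw [hg', inv_mul_cancel_right]

variable [NormedSpace ℂ E] [LieGroup 𝓘(ℂ, E) ω G]
  {Q : Type*} [TopologicalSpace Q] [ChartedSpace E Q] [IsManifold 𝓘(ℂ, E) ω Q]
  {η : ∀ x : Q, TangentSpace 𝓘(ℂ, E) x [⋀^Fin 2]→L[ℝ] ℝ} {π : G → Q} {U : Set Q}

theorem continuousAt_pairing (hη : IsKahlerFormOn η U) (hU : IsOpen U)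
    (hπ : ContMDiff 𝓘(ℂ, E) 𝓘(ℂ, E) ω π) {g : G} (hg : π g ∈ U) (V W : E) :
    ContinuousAt (pairing η π V W) g := by
  have h1 := (hasStrictFDerivAt_pairing hη hU hπ hg V W).hasFDerivAt.continuousAt.tendsto.comp
    (tendsto_chart_mul_inv g)
  simp only [chart_symm_baseCoord, one_mul] at h1
  refine h1.congr' ?_
  filter_upwards [eventually_chart_symm_mul (E := E) g] with g' hg'
  simp only [Function.comp_apply, hg']

/-- The derivative of `pairing η π V W` along a curve, locally uniformly in the base point. -/
theorem isLittleO_pairing (hη : IsKahlerFormOn η U) (hU : IsOpen U)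
    (hπ : ContMDiff 𝓘(ℂ, E) 𝓘(ℂ, E) ω π) {g : G} (hg : π g ∈ U) (V W : E) {γ : ℝ → G} {X : E}
    (hγ : HasVelocity E γ X) :
    (fun q : G × ℝ => pairing η π V W (γ q.2 * q.1) - pairing η π V W q.1 -
      q.2 * pairingDeriv η π X V W g) =o[𝓝 g ×ˢ 𝓝 0] fun q => q.2 := by
  set F : E → ℝ := fun y => pairing η π V W ((chartAt E (1 : G)).symm y * g) with hF
  have hFs := hasStrictFDerivAt_pairing hη hU hπ hg V W
  set L := fderiv ℝ F (baseCoord E G) with hL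
  have hm := ((contDiffAt_coordMul (E := E) (G := G)).hasStrictFDerivAt (by simp))
  rw [(hasFDerivAt_coordMul (E := E) (G := G)).fderiv] at hm
  have hc : HasStrictFDerivAt (fun p : E × E => F (coordMul E G p))
      (L.comp ((ContinuousLinearMap.fst ℂ E E + ContinuousLinearMap.snd ℂ E E).restrictScalars ℝ))
      (baseCoord E G, baseCoord E G) := by
    refine HasStrictFDerivAt.comp (baseCoord E G, baseCoord E G) (g' := L) ?_
      (hm.restrictScalars ℝ)
    rwa [coordMul_base]
  have ht1 : Filter.Tendsto (fun q : G × ℝ => chartAt E (1 : G) (γ q.2)) (𝓝 g ×ˢ 𝓝 0)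
      (𝓝 (baseCoord E G)) := hγ.tendsto_chart.comp Filter.tendsto_snd
  have ht2 : Filter.Tendsto (fun q : G × ℝ => chartAt E (1 : G) (q.1 * g⁻¹)) (𝓝 g ×ˢ 𝓝 0)
      (𝓝 (baseCoord E G)) := (tendsto_chart_mul_inv g).comp Filter.tendsto_fst
  -- Strict differentiability compares two moving points: they differ only in the first coordinate,
  -- by the displacement of `γ`, while the shared second coordinate is the varying base point.
  have ht : Filter.Tendsto (fun q : G × ℝ =>
      (((chartAt E (1 : G) (γ q.2), chartAt E (1 : G) (q.1 * g⁻¹)),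
        (baseCoord E G, chartAt E (1 : G) (q.1 * g⁻¹))) : (E × E) × (E × E))) (𝓝 g ×ˢ 𝓝 0)
      (𝓝 ((baseCoord E G, baseCoord E G), (baseCoord E G, baseCoord E G))) :=
    (ht1.prodMk_nhds ht2).prodMk_nhds (tendsto_const_nhds.prodMk_nhds ht2)
  have ho := hc.isLittleO.comp_tendsto ht
  have hd0 := hasDerivAt_iff_isLittleO.1 hγ.hasDerivAt
  rw [hγ.chart_zero] at hd0
  simp only [sub_zero] at hd0
  have hd : (fun q : G × ℝ => chartAt E (1 : G) (γ q.2) - baseCoord E G - q.2 • X)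
      =o[𝓝 g ×ˢ 𝓝 0] fun q => q.2 := hd0.comp_tendsto Filter.tendsto_snd
  have hO : (fun q : G × ℝ => chartAt E (1 : G) (γ q.2) - baseCoord E G)
      =O[𝓝 g ×ˢ 𝓝 0] fun q => q.2 := by
    have h1 : (fun q : G × ℝ => q.2 • X) =O[𝓝 g ×ˢ 𝓝 0] fun q => q.2 :=
      Asymptotics.IsBigO.of_bound ‖X‖ (Filter.Eventually.of_forall fun q => by
        rw [norm_smul, mul_comm])
    exact (hd.isBigO.add h1).congr_left fun q => by abel
  have h1 : (fun q : G × ℝ => L (chartAt E (1 : G) (γ q.2) - baseCoord E G - q.2 • X))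
      =o[𝓝 g ×ˢ 𝓝 0] fun q => q.2 := (L.isBigO_comp _ _).trans_isLittleO hd
  have hO' : (fun q : G × ℝ => ((chartAt E (1 : G) (γ q.2), chartAt E (1 : G) (q.1 * g⁻¹)) -
      (baseCoord E G, chartAt E (1 : G) (q.1 * g⁻¹)) : E × E)) =O[𝓝 g ×ˢ 𝓝 0]
      fun q => chartAt E (1 : G) (γ q.2) - baseCoord E G :=
    Asymptotics.IsBigO.of_bound 1 (Filter.Eventually.of_forall fun q => by simp)
  have h2 := ho.trans_isBigO (hO'.trans hO)
  refine (h2.add h1).congr' ?_ Filter.EventuallyEq.rfl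
  have e1 := Filter.Eventually.prod_inl (eventually_chart_symm_mul (E := E) g) (𝓝 (0 : ℝ))
  have e2 := Filter.Eventually.prod_inr hγ.eventually_symm_chart (𝓝 g)
  have e3 := ht2.eventually (coordMul_base_left (E := E) (G := G))
  have e4 := (ht1.prodMk_nhds ht2).eventually (eventually_symm_coordMul (E := E) (G := G))
  filter_upwards [e1, e2, e3, e4] with q q1 q2 q3 q4
  simp only [Function.comp_apply, hF, q3, q4, q2, q1, mul_assoc]
  have e5 : (L.comp ((ContinuousLinearMap.fst ℂ E E +
      ContinuousLinearMap.snd ℂ E E).restrictScalars ℝ))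
      ((chartAt E (1 : G) (γ q.2), chartAt E (1 : G) (q.1 * g⁻¹)) -
        (baseCoord E G, chartAt E (1 : G) (q.1 * g⁻¹))) =
      L (chartAt E (1 : G) (γ q.2) - baseCoord E G) := by
    simp
  rw [e5]
  simp only [map_sub, map_smul, pairingDeriv, smul_eq_mul]
  ring

/-- The uniform estimate around `g` and the one centred at a nearby `g'` describe the same
increment; comparing them at one small `s > 0` bounds the difference of the derivatives by `ε / 2`.
-/
theorem continuousAt_pairingDeriv (hη : IsKahlerFormOn η U) (hU : IsOpen U)
    (hπ : ContMDiff 𝓘(ℂ, E) 𝓘(ℂ, E) ω π) {g : G} (hg : π g ∈ U) (X V W : E) :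
    ContinuousAt (pairingDeriv η π X V W) g := by
  obtain ⟨γ, hγ⟩ := HasVelocity.exists_curve (G := G) X
  refine Metric.continuousAt_iff'.2 fun ε hε => ?_
  have h1 := ((isLittleO_pairing hη hU hπ hg V W hγ).def (half_pos (half_pos hε))).curry
  filter_upwards [h1, hπ.continuous.continuousAt.eventually_mem (hU.mem_nhds hg)] with g' hg' hgU
  have h2 := (isLittleO_pairing hη hU hπ hgU V W hγ).comp_tendsto
    (Filter.tendsto_const_pure.prodMk Filter.tendsto_id |>.mono_right
      (Filter.prod_mono (pure_le_nhds g') le_rfl))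
  have h3 := (hg'.and (h2.def (half_pos (half_pos hε)))).filter_mono
    (nhdsWithin_le_nhds (s := Set.Ioi 0))
  obtain ⟨s, ⟨hs1, hs2⟩, hs⟩ := (h3.and self_mem_nhdsWithin).exists
  have hs0 : (0 : ℝ) < s := hs
  simp only [Function.comp_apply, id, Real.norm_eq_abs, abs_of_pos hs0] at hs1 hs2
  rw [abs_le] at hs1 hs2
  have h4 : s * |pairingDeriv η π X V W g' - pairingDeriv η π X V W g| ≤ s * (ε / 2) := by
    rw [← abs_of_pos hs0, ← abs_mul, abs_of_pos hs0, abs_le]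
    constructor <;> linarith [hs1.1, hs1.2, hs2.1, hs2.2]
  rw [Real.dist_eq]
  exact (le_of_mul_le_mul_left h4 hs0).trans_lt (half_lt_self hε)

/-- Here the derivative is taken at the varying point, so the estimate can be made uniform over all
of `G₀` and averaged. -/
theorem isLittleO_pairing_sub (hη : IsKahlerFormOn η U) (hU : IsOpen U)
    (hπ : ContMDiff 𝓘(ℂ, E) 𝓘(ℂ, E) ω π) {g : G} (hg : π g ∈ U) (V W : E) {γ : ℝ → G} {X : E}
    (hγ : HasVelocity E γ X) :
    (fun q : G × ℝ => pairing η π V W (γ q.2 * q.1) - pairing η π V W q.1 -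
      q.2 * pairingDeriv η π X V W q.1) =o[𝓝 g ×ˢ 𝓝 0] fun q => q.2 := by
  have h1 : (fun q : G × ℝ => pairingDeriv η π X V W q.1 - pairingDeriv η π X V W g)
      =o[𝓝 g ×ˢ 𝓝 0] fun _ => (1 : ℝ) := by
    rw [Asymptotics.isLittleO_one_iff, ← sub_self (pairingDeriv η π X V W g)]
    exact ((continuousAt_pairingDeriv hη hU hπ hg X V W).tendsto.sub_const _).comp
      Filter.tendsto_fst
  have h2 := (Asymptotics.isBigO_refl (fun q : G × ℝ => q.2) (𝓝 g ×ˢ 𝓝 0)).mul_isLittleO h1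
  simp only [mul_one] at h2
  exact ((isLittleO_pairing hη hU hπ hg V W hγ).sub h2).congr_left fun q => by ring

end Derivative

/-! ### Averaging over the real group -/

section Mean

/-- Invariance kills the mean of `f (γ s * x) - f x`, so `s * Λ D` is at most `ε * s` in absolute
value. -/
theorem IsInvariantMean.eq_zero_of_hasUniformDeriv {H : Type*} [Group H] {Λ : (H → ℝ) →ₗ[ℝ] ℝ}
    (hΛ : IsInvariantMean Λ) {f D : H → ℝ} (hf : IsBdd f) {γ : ℝ → H}
    (h : ∀ ε > 0, ∀ᶠ s in 𝓝 (0 : ℝ), ∀ x, |f (γ s * x) - f x - s * D x| ≤ ε * |s|) : Λ D = 0 := by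
  refine abs_eq_zero.1 (le_antisymm (le_of_forall_gt_imp_ge_of_dense fun ε hε => ?_) (abs_nonneg _))
  obtain ⟨s, hs, hs0⟩ := (((h ε hε).filter_mono
    (nhdsWithin_le_nhds (s := Set.Ioi 0))).and self_mem_nhdsWithin).exists
  have hs0' : (0 : ℝ) < s := hs0
  have h1 : Λ ((fun x => f (γ s * x)) - f - s • D) = - (s * Λ D) := by
    rw [map_sub, map_sub, map_smul, hΛ.inv f hf]
    simp
  have h2 : |Λ ((fun x => f (γ s * x)) - f - s • D)| ≤ ε * |s| := hΛ.abs_le hs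
  rw [h1, abs_neg, abs_mul, abs_of_pos hs0', mul_comm ε] at h2
  exact le_of_mul_le_mul_left h2 hs0'

variable {E : Type*} [NormedAddCommGroup E] [NormedSpace ℂ E]
  {G : Type*} [TopologicalSpace G] [ChartedSpace E G] [Group G] [LieGroup 𝓘(ℂ, E) ω G]
  {Q : Type*} [TopologicalSpace Q] [ChartedSpace E Q] [IsManifold 𝓘(ℂ, E) ω Q]
  {η : ∀ x : Q, TangentSpace 𝓘(ℂ, E) x [⋀^Fin 2]→L[ℝ] ℝ} {π : G → Q} {U : Set Q}

theorem pairing_add_left (hπ : ContMDiff 𝓘(ℂ, E) 𝓘(ℂ, E) ω π) (g : G) (V V' W : E) :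
    pairing η π (V + V') W g = pairing η π V W g + pairing η π V' W g := by
  simp only [pairing_eq_localForm hπ]
  exact (localForm η π g (baseCoord E G)).toAlternatingMap.map_vecCons_add ![W] V V'

theorem pairing_smul_left (hπ : ContMDiff 𝓘(ℂ, E) 𝓘(ℂ, E) ω π) (g : G) (c : ℝ) (V W : E) :
    pairing η π (c • V) W g = c * pairing η π V W g := by
  simp only [pairing_eq_localForm hπ]
  exact (localForm η π g (baseCoord E G)).toAlternatingMap.map_vecCons_smul ![W] c V

/-- Averaging the form `η` over `G₀`. -/
theorem exists_averaged_form {Γ G₀ : Subgroup G} [CompactSpace (G₀ ⧸ Γ.subgroupOf G₀)]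
    [Group.IsNilpotent G₀] (hη : IsKahlerFormOn η U) (hU : IsOpen U)
    (hπ : ContMDiff 𝓘(ℂ, E) 𝓘(ℂ, E) ω π) (hΓ : ∀ γ ∈ Γ, ∀ x, π (x * γ) = π x)
    (hinj : ∀ g, Function.Injective (orbitDeriv (E := E) π g (baseCoord E G)))
    (hG₀ : ∀ g ∈ G₀, π g ∈ U) :
    ∃ β : E → E → ℝ, (∀ x y z, β (x + y) z = β x z + β y z) ∧
      (∀ (c : ℝ) x z, β (c • x) z = c * β x z) ∧ (∀ v ≠ 0, 0 < β v (Complex.I • v)) ∧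
      ∀ x ∈ subLieSubmodule E G₀, ∀ y ∈ subLieSubmodule E G₀, ∀ z ∈ subLieSubmodule E G₀,
        β (coordBracket E G x y) z + β (coordBracket E G y z) x +
          β (coordBracket E G z x) y = 0 := by
  have : IsTopologicalGroup G := topologicalGroup_of_lieGroup 𝓘(ℂ, E) ω
  obtain ⟨Λ, hΛ⟩ := exists_isInvariantMean G₀
  have hadd : ∀ x y z : E, Λ (fun g => pairing η π (x + y) z g) =
      Λ (fun g => pairing η π x z g) + Λ (fun g => pairing η π y z g) := fun x y z => by
    rw [← map_add]
    exact congrArg Λ (funext fun g => pairing_add_left hπ g x y z)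
  have hsmul : ∀ (c : ℝ) (x z : E), Λ (fun g => pairing η π (c • x) z g) =
      c * Λ (fun g => pairing η π x z g) := fun c x z => by
    rw [← smul_eq_mul, ← map_smul]
    exact congrArg Λ (funext fun g => pairing_smul_left hπ g c x z)
  have hbdd : ∀ V W : E, IsBdd fun g : G₀ => pairing η π V W g := fun V W => by
    obtain ⟨C, hC⟩ := exists_abs_le_of_cocompact (Γ := Γ)
      (fun γ hγ => pairing_mul_right (hΓ γ hγ) V W)
      fun g hg => continuousAt_pairing hη hU hπ (hG₀ g hg) V W
    exact ⟨C, fun g => hC g g.2⟩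
  have hderiv : ∀ X ∈ subLieSubmodule E G₀, ∀ V W : E,
      Λ (fun g => pairingDeriv η π X V W g) = 0 := fun X hX V W => by
    obtain ⟨γ, -, hγ₀, hγ⟩ := mem_subLieSubmodule.1 hX
    refine hΛ.eq_zero_of_hasUniformDeriv (hbdd V W) (γ := fun t => ⟨γ t, hγ₀ t⟩)
      fun ε hε => ?_
    have h := eventually_forall_mem_of_cocompact (Γ := Γ) (G₀ := G₀) (l := 𝓝 (0 : ℝ))
      (p := fun g s => |pairing η π V W (γ s * g) - pairing η π V W g -
        s * pairingDeriv η π X V W g| ≤ ε * |s|)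
      (fun δ hδ g s h => by
        rwa [← mul_assoc, pairing_mul_right (hΓ δ hδ), pairing_mul_right (hΓ δ hδ),
          pairingDeriv_mul_right (hΓ δ hδ)])
      fun g hg => (isLittleO_pairing_sub hη hU hπ (hG₀ g hg) V W hγ).def hε
    filter_upwards [h] with s hs g
    exact hs g g.2
  refine ⟨fun V W => Λ fun g => pairing η π V W g, hadd, hsmul, fun v hv => ?_,
    fun x hx y hy z hz => ?_⟩
  -- Pointwise positivity alone would not survive a mean; the uniform lower bound `c` does.
  · obtain ⟨c, hc, hcle⟩ := exists_pos_le_of_cocompact (Γ := Γ) (G₀ := G₀)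
      (fun γ hγ => pairing_mul_right (hΓ γ hγ) v (Complex.I • v))
      (fun g hg => continuousAt_pairing hη hU hπ (hG₀ g hg) v (Complex.I • v))
      fun g hg => by
        rw [pairing, map_smul]
        exact hη.pos _ (hG₀ g hg) _ fun h => hv (hinj g (h.trans (map_zero _).symm))
    exact hc.trans_le (hΛ.ge (hbdd _ _) fun g => hcle g g.2)
  · have h1 : (fun g : G₀ => pairing η π (coordBracket E G x y) z g) +
        (fun g : G₀ => pairing η π (coordBracket E G y z) x g) +
        (fun g : G₀ => pairing η π (coordBracket E G z x) y g) =
        (fun g : G₀ => pairingDeriv η π y x z g) - (fun g : G₀ => pairingDeriv η π x y z g) -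
          fun g : G₀ => pairingDeriv η π z x y g := by
      funext g
      have h := pairingDeriv_cyclic hη hU hπ (hG₀ g g.2) x y z
      -- Turns the bracket of `x` and `z` into that of `z` and `x`, for the cyclic form of the
      -- identity.
      have h' := pairing_smul_left (η := η) hπ (g : G) (-1) (coordBracket E G x z) y
      rw [neg_one_smul, ← coordBracket_swap] at h'
      simp only [Pi.add_apply, Pi.sub_apply]
      linarith
    have h2 := congrArg Λ h1
    simpa only [map_add, map_sub, hderiv _ hx, hderiv _ hy, hderiv _ hz, sub_zero] using h2

end Mean


/-! ### The covering of the quotient manifold by the group -/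

section Quotient

variable (E : Type*) [NormedAddCommGroup E] [NormedSpace ℂ E]
  {G : Type*} [TopologicalSpace G] [ChartedSpace E G] [Group G] [LieGroup 𝓘(ℂ, E) ω G]
  (Γ : Subgroup G) (hΓ : DiscreteTopology Γ)

/-- In the charts of `G ⧸ Γ`, the quotient map is a right translation. -/
theorem exists_eventually_chartAt_mk (g : G) :
    letI := quotientChartedSpace E Γ hΓ
    ∃ c : G, ∀ᶠ x : G in 𝓝 g, chartAt E (g : G ⧸ Γ) (x : G ⧸ Γ) = chartAt E (g * c) (x * c) := by
  let _ := quotientChartedSpace E Γ hΓ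
  have hG : IsTopologicalGroup G := topologicalGroup_of_lieGroup 𝓘(ℂ, E) ω
  have hl := isLocalHomeomorph_mk E Γ hΓ
  obtain ⟨b, hb, hchart⟩ : ∃ b : G, (b : G ⧸ Γ) = g ∧
      chartAt E (g : G ⧸ Γ) = (hl.localInverseAt b) ≫ₕ chartAt E b :=
    ⟨_, (QuotientGroup.mk_surjective (s := Γ)).hasRightInverse.choose_spec (g : G ⧸ Γ), rfl⟩
  have hc : g⁻¹ * b ∈ Γ := QuotientGroup.eq.1 hb.symm
  refine ⟨g⁻¹ * b, ?_⟩
  have h1 : ContinuousAt (fun x => x * (g⁻¹ * b)) g := by fun_prop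
  have h2 : ∀ᶠ x in 𝓝 g, x * (g⁻¹ * b) ∈ (hl.localInverseAt b).target := by
    refine h1.eventually_mem ((hl.localInverseAt b).open_target.mem_nhds ?_)
    rw [mul_inv_cancel_left]
    exact hl.self_mem_localInverseAt_target
  filter_upwards [h2] with x hx
  have h3 : (x : G ⧸ Γ) = ((x * (g⁻¹ * b) : G) : G ⧸ Γ) := by
    rw [QuotientGroup.eq, inv_mul_cancel_left]
    exact hc
  have h4 := (hl.localInverseAt b).right_inv hx
  rw [IsLocalHomeomorph.localInverseAt_symm] at h4
  rw [hchart, mul_inv_cancel_left, OpenPartialHomeomorph.coe_trans, Function.comp_apply, h3, h4]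

theorem contMDiff_quotient_mk :
    letI := quotientChartedSpace E Γ hΓ
    ContMDiff 𝓘(ℂ, E) 𝓘(ℂ, E) ω (QuotientGroup.mk : G → G ⧸ Γ) := by
  let _ := quotientChartedSpace E Γ hΓ
  intro g
  refine contMDiffAt_iff_target.2 ⟨(isLocalHomeomorph_mk E Γ hΓ).continuous.continuousAt, ?_⟩
  obtain ⟨c, hc⟩ := exists_eventually_chartAt_mk E Γ hΓ g
  have h1 : ContMDiffAt 𝓘(ℂ, E) 𝓘(ℂ, E) ω (fun x => chartAt E (g * c) (x * c)) g :=
    ContMDiffAt.comp g (g := chartAt E (g * c))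
      (contMDiffAt_chart_of_mem (mem_chart_source E _)) contMDiff_mul_right.contMDiffAt
  refine h1.congr_of_eventuallyEq ?_
  filter_upwards [hc] with x hx
  simpa using hx

/-- The orbit map has a holomorphic local left inverse, whose derivative is a left inverse of
`orbitDeriv`. -/
theorem injective_orbitDeriv_mk (g : G) :
    letI := quotientChartedSpace E Γ hΓ
    Function.Injective (orbitDeriv (E := E) (QuotientGroup.mk : G → G ⧸ Γ) g (baseCoord E G)) := by
  let _ := quotientChartedSpace E Γ hΓ
  have hM := isManifold_quotient E Γ hΓ
  have hG : IsTopologicalGroup G := topologicalGroup_of_lieGroup 𝓘(ℂ, E) ω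
  obtain ⟨c, hc⟩ := exists_eventually_chartAt_mk E Γ hΓ g
  have h1 := (contMDiffAt_orbitMap (contMDiff_quotient_mk E Γ hΓ) g
    (baseCoord_mem (E := E) (G := G))).mdifferentiableAt (by simp)
  have hr : Filter.Tendsto (fun y => (chartAt E (1 : G)).symm y * g) (𝓝 (baseCoord E G))
      (𝓝 g) := by
    have := (continuousAt_chart_symm_base (E := E) (G := G)).tendsto.mul_const g
    rwa [chart_symm_baseCoord, one_mul] at this
  -- The left inverse: the chart at `g Γ` reads `x Γ` as the coordinate of `x * c`, so lift through
  -- the chart at `g * c`, divide by `g * c` on the right and return to the chart at `1`.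
  have hk : ContMDiffAt 𝓘(ℂ, E) 𝓘(ℂ, E) ω (fun q : G ⧸ Γ => chartAt E (1 : G)
      ((chartAt E (g * c)).symm (chartAt E (g : G ⧸ Γ) q) * (g * c)⁻¹))
      (orbitMap (QuotientGroup.mk : G → G ⧸ Γ) g (baseCoord E G)) := by
    rw [orbitMap_base]
    have e1 : ContMDiffAt 𝓘(ℂ, E) 𝓘(ℂ, E) ω (chartAt E (g : G ⧸ Γ)) (g : G ⧸ Γ) :=
      (contMDiffOn_chart (I := 𝓘(ℂ, E)) (n := ω) (x := (g : G ⧸ Γ))).contMDiffAt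
        ((chartAt E (g : G ⧸ Γ)).open_source.mem_nhds (mem_chart_source E _))
    have e2 : ContMDiffAt 𝓘(ℂ, E) 𝓘(ℂ, E) ω (chartAt E (g * c)).symm
        (chartAt E (g : G ⧸ Γ) (g : G ⧸ Γ)) := by
      rw [hc.self_of_nhds]
      exact contMDiffAt_chart_symm_of_mem (mem_chart_target E _)
    have e3 := (ContMDiffAt.comp (g : G ⧸ Γ) e2 e1).mul
      (contMDiffAt_const (c := (g * c)⁻¹))
    refine ContMDiffAt.comp (g : G ⧸ Γ) (g := chartAt E (1 : G)) (contMDiffAt_chart_of_mem ?_) e3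
    rw [hc.self_of_nhds,
      (chartAt E (g * c)).left_inv (mem_chart_source E _), mul_inv_cancel]
    exact mem_chart_source E 1
  have h2 := HasMFDerivAt.comp (I' := 𝓘(ℂ, E)) (baseCoord E G)
    (hk.mdifferentiableAt (by simp)).hasMFDerivAt h1.hasMFDerivAt
  have h3 : ∀ᶠ x in 𝓝 g, x * c ∈ (chartAt E (g * c)).source := by
    have : ContinuousAt (fun x => x * c) g := by fun_prop
    exact this.eventually_mem ((chartAt E (g * c)).open_source.mem_nhds (mem_chart_source E _))
  have h4 := h2.congr_of_eventuallyEq (f₁ := id) (by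
    filter_upwards [hr.eventually hc, hr.eventually h3,
      eventually_chart_right_inv (E := E) (G := G)] with y hy1 hy2 hy3
    simp only [Function.comp_apply, orbitMap] at hy1 ⊢
    rw [hy1, (chartAt E (g * c)).left_inv hy2]
    simp [mul_assoc, hy3])
  have h5 := hasMFDerivAt_unique h4 (hasMFDerivAt_id _)
  refine Function.HasLeftInverse.injective ⟨_, fun v => DFunLike.congr_fun h5 v⟩

end Quotient

end CRSolv

theorem corollary2 {E : Type*} [NormedAddCommGroup E] [NormedSpace ℂ E] [FiniteDimensional ℂ E]
    {G : Type*} [TopologicalSpace G] [ChartedSpace E G] [Group G] [LieGroup 𝓘(ℂ, E) ω G]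
    (Γ G₀ : Subgroup G) (h : CRSolv.IsCRSolvmanifold E Γ G₀) (hK : h.IsLocallyKahler)
    (hG : Group.IsNilpotent G) :
    (∃ 𝔪 : LieIdeal ℂ (GroupLieAlgebra 𝓘(ℂ, E) G),
      (𝔪 : Set (GroupLieAlgebra 𝓘(ℂ, E) G)) = CRSolv.complexPart E G₀ ∧
      𝔪 ≤ LieAlgebra.center ℂ (GroupLieAlgebra 𝓘(ℂ, E) G) ∧
      𝔪 ⊓ ⁅(⊤ : LieIdeal ℂ (GroupLieAlgebra 𝓘(ℂ, E) G)),
        (⊤ : LieIdeal ℂ (GroupLieAlgebra 𝓘(ℂ, E) G))⁆ = ⊥) ∧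
    (LieAlgebra.center ℂ (GroupLieAlgebra 𝓘(ℂ, E) G) : Set (GroupLieAlgebra 𝓘(ℂ, E) G)) =
      CRSolv.centerSubLie E G₀ + Complex.I • CRSolv.centerSubLie E G₀ := by
  let _ := CRSolv.quotientChartedSpace E Γ h.discrete
  have hM := CRSolv.isManifold_quotient E Γ h.discrete
  have hcpt := h.cocompact
  obtain ⟨U, η, hU, hG₀U, hη⟩ := hK
  -- The nilpotency of `G₀` needed for the mean is inherited from `G`.
  obtain ⟨β, hadd, hsmul, hpos, hclosed⟩ := CRSolv.exists_averaged_form (Γ := Γ) (G₀ := G₀) hη hU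
    (CRSolv.contMDiff_quotient_mk E Γ h.discrete)
    (fun γ hγ x => QuotientGroup.mk_mul_of_mem x hγ)
    (CRSolv.injective_orbitDeriv_mk E Γ h.discrete) fun g hg => hG₀U ⟨g, hg, rfl⟩
  have hS := CRSolv.coe_subLieSubmodule (E := E) G₀
  have hgen := h.generic
  obtain ⟨n, hn⟩ := CRSolv.exists_adjointFiltration_eq_top (E := E) hG
  simp only [CRSolv.complexPart, CRSolv.centerSubLie]
  rw [← hS] at hgen ⊢
  exact CRSolv.structure_of_closed_form (L := GroupLieAlgebra 𝓘(ℂ, E) G)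
    (CRSolv.subLieSubmodule E G₀) (fun x hx y hy => CRSolv.lie_mem_subLieSubmodule (E := E) hx hy)
    hgen β hadd hsmul hpos (fun x hx y hy z hz => by
      rw [CRSolv.bracket_eq_sub, CRSolv.bracket_eq_sub, CRSolv.bracket_eq_sub]
      exact hclosed x hx y hy z hz)
    (fun j => (CRSolv.adjointFiltration E G j : Set E)) rfl
    (fun j v hv x => CRSolv.lie_mem_adjointFiltration (E := E) hv) ⟨n, by rw [hn]; rfl⟩
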